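/- **Setting.** A set $M=\{e_1,\dots,e_m\}$ of indivisible goods is to be allocated to $n$ agents $N$ with weights $w_i>0$, $\sum_{i\in N} w_i=1$, and additive valuations $v_i$ with $0\le v_i(e)\le 1$ for all $i\in N$, $e\in M$. The instance has identical ordering: $v_i(e_1)\le v_i(e_2)\le\dots\le v_i(e_m)$ for every $i$. Put $\mathsf{WPROP}_i=w_i\cdot v_i(M)$. An allocation $\mathbf X=(X_1,\dots,X_n)$ (a partition of $M$) with subsidies $s_1,\dots,s_n\ge 0$ is *weighted proportional with subsidies* (WPROPS) if $v_i(X_i)+s_i\ge \mathsf{WPROP}_i$ for all $i$; its total subsidy is $\sum_i s_i$. **Fractional Bid-and-Take algorithm for goods.** Initially no item is allocated (all $x_i(e)=0$), all agents are active ($A=N$), and every item $e_j$ has remaining fraction $z_j=1$. The items are processed in the order $e_1,\dots,e_m$. For the current item $e_j$, let $i$ be an agent of $A$ with maximum $v_i(e_j)/v_i(M)$ (ties resolved arbitrarily; the ratio is read as $0$ if $v_i(M)=0$), and let $v_i(\mathbf x_i)=\sum_{e} x_i(e)v_i(e)$ be the value of her current bundle. If $v_i(\mathbf x_i)+z_j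 v_i(e_j)\le \mathsf{WPROP}_i$, then $i$ receives all the remaining fraction $z_j$ of $e_j$, and the algorithm moves on to $e_{j+1}$. Otherwise $i$ receives the fraction $(\mathsf{WPROP}_i-v_i(\mathbf x_i))/v_i(e_j)$ of $e_j$, which is subtracted from $z_j$, and $i$ is removed from $A$; if then $|A|=1$, the only active agent receives everything that remains of all items and the algorithm stops; otherwise it continues with the remaining fraction of $e_j$. The output is the fractional allocation $\mathbf x=(x_i(e))_{i\in N,e\in M}$. An item $e$ is *fractional* in $\mathbf x$ if $x_i(e)>0$ for at least two agents $i$. A *rounding* of $\mathbf x$ is an integral allocation $\mathbf X$ in which every item $e$ is given entirely to some agent $i$ with $x_i(e)>0$. **Theorem.** Let $\mathbf x$ be a fractional allocation returned by this algorithm. Then $\mathbf x$ has at most $n-1$ fractional items, and: 1. if $\mathbf x$ has exactly $n-1$ fractional items, then there is a rounding of $\mathbf x$ that is WPROPS with total subsidy at most $n/3$; 2. if $\mathbf x$ has fewer than $n-1$ fractional items, then there is a rounding of $\mathbf x$ that is WPROPS with total subsidy at most $(n-1)/3$. -/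

import Mathlib

/-- An instance of the weighted allocation of `m` indivisible goods to `n` agents: positive weights
that sum to one, and additive valuations, given by their values in `[0, 1]` on single items. -/
structure GoodsInstance (n m : ℕ) where
  w : Fin n → ℝ
  v : Fin n → Fin m → ℝ
  w_pos : ∀ i, 0 < w i
  w_sum : ∑ i, w i = 1
  v_nonneg : ∀ i e, 0 ≤ v i e
  v_le_one : ∀ i e, v i e ≤ 1

/-- A fractional allocation: `x i e` is the fraction of item `e` that agent `i` receives. -/
abbrev FracAllocation (n m : ℕ) := Fin n → Fin m → ℝ

/-- Identical ordering: all agents weakly prefer later items, `v i e₁ ≤ v i e₂ ≤ ⋯ ≤ v i eₘ`. -/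
def GoodsInstance.IsIDO {n m : ℕ} (I : GoodsInstance n m) : Prop :=
  ∀ i, Monotone (I.v i)

/-- The value of the bundle `S` for agent `i`. -/
noncomputable def GoodsInstance.value {n m : ℕ} (I : GoodsInstance n m) (i : Fin n)
    (S : Finset (Fin m)) : ℝ :=
  ∑ e ∈ S, I.v i e

/-- The value `v i M` of the set of all items for agent `i`. -/
noncomputable def GoodsInstance.total {n m : ℕ} (I : GoodsInstance n m) (i : Fin n) : ℝ :=
  I.value i Finset.univ

/-- The weighted proportional share `WPROP i = w i * v i M`. -/
noncomputable def GoodsInstance.share {n m : ℕ} (I : GoodsInstance n m) (i : Fin n) : ℝ :=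
  I.w i * I.total i

/-- The value of the fractional bundle `y` for agent `i`. -/
noncomputable def GoodsInstance.fracValue {n m : ℕ} (I : GoodsInstance n m) (i : Fin n)
    (y : Fin m → ℝ) : ℝ :=
  ∑ e, y e * I.v i e

/-- A state of the fractional bid-and-take algorithm: the current fractional bundles, the set of
active agents, the remaining fraction of every item, and the number `j` of the current item
(items are numbered from `0`, so the main loop runs while `j < m`). -/
structure FBTAState (n m : ℕ) where
  x : FracAllocation n m
  active : Finset (Fin n)
  z : Fin m → ℝ
  j : ℕ

/-- The initial state: nothing is allocated, and all agents are active. -/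
def FBTAState.init (n m : ℕ) : FBTAState n m where
  x := fun _ _ => 0
  active := Finset.univ
  z := fun _ => 1
  j := 0

/-- The fractional allocation that results from `x` by setting `x i e` to `a`. -/
def FracAllocation.set {n m : ℕ} (x : FracAllocation n m) (i : Fin n) (e : Fin m) (a : ℝ) :
    FracAllocation n m :=
  Function.update x i (Function.update (x i) e a)

/-- `i` is an active agent with the largest ratio `v i e / v i M` among the active agents, with any
resolution of ties. (The ratio of an agent who values all items at zero is `0 / 0 = 0`.) -/
def GoodsInstance.IsTopBidder {n m : ℕ} (I : GoodsInstance n m) (A : Finset (Fin n)) (e : Fin m)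
    (i : Fin n) : Prop :=
  i ∈ A ∧ ∀ k ∈ A, I.v k e / I.total k ≤ I.v i e / I.total i

/-- One iteration of the main loop of the fractional bid-and-take algorithm for goods. -/
inductive GoodsInstance.FBTAStep {n m : ℕ} (I : GoodsInstance n m) :
    FBTAState n m → FBTAState n m → Prop
  /-- The top bidder takes all that remains of the current item. -/
  | take (s : FBTAState n m) (e : Fin m) (i : Fin n)
      (he : s.j = e) (hi : I.IsTopBidder s.active e i)
      (hle : I.fracValue i (s.x i) + s.z e * I.v i e ≤ I.share i) :
      I.FBTAStep s
        { x := s.x.set i e (s.z e)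
          active := s.active
          z := Function.update s.z e 0
          j := s.j + 1 }
  /-- The top bidder takes the amount `a` that fills her share and becomes inactive; the number of
  agents that are still active is not one. -/
  | leave (s : FBTAState n m) (e : Fin m) (i : Fin n) (a : ℝ)
      (he : s.j = e) (hi : I.IsTopBidder s.active e i)
      (hgt : I.share i < I.fracValue i (s.x i) + s.z e * I.v i e)
      (ha : a = (I.share i - I.fracValue i (s.x i)) / I.v i e)
      (hcard : (s.active.erase i).card ≠ 1) :
      I.FBTAStep s
        { x := s.x.set i e a
          active := s.active.erase i
          z := Function.update s.z e (s.z e - a)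
          j := s.j }
  /-- The top bidder takes the amount `a` that fills her share and becomes inactive; a single agent
  `k` is still active and receives all that remains of all items, and the loop ends. -/
  | last (s : FBTAState n m) (e : Fin m) (i k : Fin n) (a : ℝ) (z' : Fin m → ℝ)
      (he : s.j = e) (hi : I.IsTopBidder s.active e i)
      (hgt : I.share i < I.fracValue i (s.x i) + s.z e * I.v i e)
      (ha : a = (I.share i - I.fracValue i (s.x i)) / I.v i e)
      (hk : s.active.erase i = {k})
      (hz : z' = Function.update s.z e (s.z e - a)) :
      I.FBTAStep s
        { x := Function.update (s.x.set i e a) k (fun e' => s.x k e' + z' e')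
          active := {k}
          z := fun _ => 0
          j := m }

/-- `x` is a fractional allocation that the fractional bid-and-take algorithm for goods returns on
the instance `I`, for some resolution of ties. -/
def GoodsInstance.IsFBTAOutput {n m : ℕ} (I : GoodsInstance n m) (x : FracAllocation n m) : Prop :=
  ∃ s : FBTAState n m,
    Relation.ReflTransGen I.FBTAStep (FBTAState.init n m) s ∧ s.j = m ∧ s.x = x

/-- The set `N(e)` of the agents that receive a positive fraction of the item `e`. -/
noncomputable def FracAllocation.holders {n m : ℕ} (x : FracAllocation n m) (e : Fin m) :
    Finset (Fin n) :=
  {i | 0 < x i e}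

/-- The set of fractional items: those that at least two agents hold a positive fraction of. -/
noncomputable def FracAllocation.fractionalItems {n m : ℕ} (x : FracAllocation n m) :
    Finset (Fin m) :=
  {e | 2 ≤ (x.holders e).card}

/-- `X` is an integral allocation: the bundles `X i` partition the set of items. -/
def IsIntegralAllocation {n m : ℕ} (X : Fin n → Finset (Fin m)) : Prop :=
  (∀ i k, i ≠ k → Disjoint (X i) (X k)) ∧ ∀ e, ∃ i, e ∈ X i

/-- The integral allocation `X` is a rounding of `x`: every item goes to an agent who holds a
positive fraction of it. -/
def FracAllocation.IsRounding {n m : ℕ} (x : FracAllocation n m) (X : Fin n → Finset (Fin m)) :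
    Prop :=
  IsIntegralAllocation X ∧ ∀ i, ∀ e ∈ X i, 0 < x i e

/-- The allocation `X` with the nonnegative subsidies `s` is weighted proportional. -/
def GoodsInstance.IsWPROPS {n m : ℕ} (I : GoodsInstance n m) (X : Fin n → Finset (Fin m))
    (s : Fin n → ℝ) : Prop :=
  (∀ i, 0 ≤ s i) ∧ ∀ i, I.share i ≤ I.value i (X i) + s i

/-- Some rounding of `x` is weighted proportional with subsidies of total at most `B`. -/
def GoodsInstance.HasRoundingWithSubsidy {n m : ℕ} (I : GoodsInstance n m)
    (x : FracAllocation n m) (B : ℝ) : Prop :=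
  ∃ (X : Fin n → Finset (Fin m)) (s : Fin n → ℝ),
    x.IsRounding X ∧ I.IsWPROPS X s ∧ ∑ i, s i ≤ B

open Finset

section

variable {n m : ℕ}

/-- The potentials of the agents in a rounding process in which every departing agent has shared
one item with one other agent. -/
structure IsPotential (φ : ℝ → ℝ) : Prop where
  anti : ∀ s t, 0 ≤ s → s ≤ t → φ t ≤ φ s
  zero_le : φ 0 ≤ 1 / 6
  tail : ∀ t, 0 ≤ t → φ 0 ≤ 0 ∨ φ t ≤ -(1 / 3) ∨ φ 0 + φ t ≤ 1 / 3 - t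

/-- The potentials of agents in whose component some slack has been gained. -/
structure IsSlackPotential (φ : ℝ → ℝ) : Prop where
  anti : ∀ s t, 0 ≤ s → s ≤ t → φ t ≤ φ s
  zero_le : φ 0 ≤ 0
  two_tail : ∀ t, 0 ≤ t → 2 * φ 0 + φ t ≤ -t ∨ 2 * φ 0 + φ t ≤ -(1 / 3)
  tail : ∀ t, 0 ≤ t → φ 0 + φ t ≤ 1 / 8 - t ∨ φ 0 + φ t ≤ -(1 / 3)

theorem IsSlackPotential.isPotential {φ : ℝ → ℝ} (h : IsSlackPotential φ) : IsPotential φ :=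
  { anti := h.anti
    zero_le := h.zero_le.trans (by norm_num)
    tail := fun _ _ => Or.inl h.zero_le }

theorem IsPotential.tail_of_pos {φ : ℝ → ℝ} (h : IsPotential φ) (h0 : 0 < φ 0) {t : ℝ}
    (ht : 0 ≤ t) : φ t ≤ -(1 / 3) ∨ φ 0 + φ t ≤ 1 / 3 - t :=
  (h.tail t ht).resolve_left h0.not_ge

theorem isPotential_zero : IsPotential (fun _ => 0) where
  anti _ _ _ _ := le_rfl
  zero_le := by norm_num
  tail _ _ := Or.inl le_rfl

theorem IsPotential.sub_sixth {φ : ℝ → ℝ} (h : IsPotential φ) :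
    IsSlackPotential (fun t => φ t - 1 / 6) where
  anti s t hs hst := by linarith [h.anti s t hs hst]
  zero_le := by linarith [h.zero_le]
  two_tail t ht := by
    have h0 := h.zero_le
    have h1 := h.anti 0 t le_rfl ht
    rcases h.tail t ht with h2 | h2 | h2
    · right; linarith
    · right; linarith
    · left; linarith
  tail t ht := by
    have h0 := h.zero_le
    have h1 := h.anti 0 t le_rfl ht
    rcases h.tail t ht with h2 | h2 | h2
    · right; linarith
    · right; linarith
    · left; linarith

/-- The potential of an agent with potential `φ` who may take the fraction `r` that remains of an
item: either she gets the item, at the additional cost `U`, or one of its earlier holders gets it,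
at the additional cost `P`. -/
noncomputable def combinePotential (U P r : ℝ) (φ : ℝ → ℝ) (t : ℝ) : ℝ :=
  min (U + φ (t + (1 - r))) (P + φ (max (t - r) 0) + max (r - t) 0)

theorem combinePotential_anti {φ : ℝ → ℝ} (h : ∀ s t, 0 ≤ s → s ≤ t → φ t ≤ φ s) (U P : ℝ) {r : ℝ}
    (hr1 : r ≤ 1) (s t : ℝ) (hs : 0 ≤ s) (hst : s ≤ t) :
    combinePotential U P r φ t ≤ combinePotential U P r φ s := by
  unfold combinePotential
  refine min_le_min ?_ ?_
  · linarith [h (s + (1 - r)) (t + (1 - r)) (by linarith) (by linarith)]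
  · have := h (max (s - r) 0) (max (t - r) 0) (le_max_right _ _)
      (max_le_max (by linarith) le_rfl)
    have : max (r - t) 0 ≤ max (r - s) 0 := max_le_max (by linarith) le_rfl
    linarith

theorem combinePotential_le_left (U P r : ℝ) (φ : ℝ → ℝ) (t : ℝ) :
    combinePotential U P r φ t ≤ U + φ (t + (1 - r)) :=
  min_le_left _ _

theorem combinePotential_le_of_le {r t : ℝ} (U P : ℝ) (φ : ℝ → ℝ) (h : t ≤ r) :
    combinePotential U P r φ t ≤ P + φ 0 + (r - t) :=
  (min_le_right _ _).trans (by simp [h])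

theorem combinePotential_le_of_ge {r t : ℝ} (U P : ℝ) (φ : ℝ → ℝ) (h : r ≤ t) :
    combinePotential U P r φ t ≤ P + φ (t - r) :=
  (min_le_right _ _).trans (by simp [h])

theorem combinePotential_zero_le (U P r : ℝ) (φ : ℝ → ℝ) :
    combinePotential U P r φ 0 ≤ U + φ (1 - r) := by
  simpa using combinePotential_le_left U P r φ 0

set_option maxHeartbeats 1000000 in
theorem IsPotential.combine {ψ φ : ℝ → ℝ} (hψ : IsPotential ψ) (hφ : IsPotential φ)
    {r : ℝ} (hr0 : 0 ≤ r) (hr1 : r ≤ 1) :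
    IsPotential (combinePotential (ψ 0 + (1 - r) - 1 / 3) (ψ r - 1 / 3) r φ) := by
  have a1 := combinePotential_zero_le (ψ 0 + (1 - r) - 1 / 3) (ψ r - 1 / 3) r φ
  have a2 := combinePotential_le_of_le (ψ 0 + (1 - r) - 1 / 3) (ψ r - 1 / 3) φ hr0
  have c0 := hψ.zero_le
  have c1 := hψ.anti 0 r le_rfl hr0
  have g0 := hφ.zero_le
  have g1 := hφ.anti 0 (1 - r) le_rfl (by linarith)
  refine .mk (combinePotential_anti hφ.anti _ _ hr1) ?_ ?_
  · by_contra hcon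
    have c3 := hψ.tail r hr0
    have d0 := fun h0 => hφ.tail_of_pos h0 (t := 1 - r) (by linarith)
    push Not at hcon
    generalize combinePotential (ψ 0 + (1 - r) - 1 / 3) (ψ r - 1 / 3) r φ 0 = u at *
    generalize φ (1 - r) = f1 at *
    generalize φ 0 = f at *
    generalize ψ r = c at *
    generalize ψ 0 = d at *
    rcases le_or_gt f 0 with g | g
    · clear d0
      rcases c3 with c3 | c3 | c3 <;> linarith
    · rcases c3 with c3 | c3 | c3 <;>
      rcases d0 g with d0 | d0 <;> linarith
  · intro t ht
    have g4 := hφ.anti (1 - r) (t + (1 - r)) (by linarith) (by linarith)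
    have b1 := combinePotential_le_left (ψ 0 + (1 - r) - 1 / 3) (ψ r - 1 / 3) r φ t
    by_contra hcon
    push Not at hcon
    obtain ⟨h1, h2, h3⟩ := hcon
    rcases le_total t r with h' | h'
    · have b2 := combinePotential_le_of_le (ψ 0 + (1 - r) - 1 / 3) (ψ r - 1 / 3) φ h'
      have c3 := hψ.tail r hr0
      have d0 := fun h0 => hφ.tail_of_pos h0 (t := 1 - r) (by linarith)
      have d1 := fun h0 => hφ.tail_of_pos h0 (t := t + (1 - r)) (by linarith)
      generalize combinePotential (ψ 0 + (1 - r) - 1 / 3) (ψ r - 1 / 3) r φ 0 = u at *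
      generalize combinePotential (ψ 0 + (1 - r) - 1 / 3) (ψ r - 1 / 3) r φ t = v at *
      generalize φ (t + (1 - r)) = f2 at *
      generalize φ (1 - r) = f1 at *
      generalize φ 0 = f at *
      generalize ψ r = c at *
      generalize ψ 0 = d at *
      rcases le_or_gt f 0 with g | g
      · clear d0 d1
        rcases c3 with c3 | c3 | c3 <;> linarith
      · rcases c3 with c3 | c3 | c3 <;>
        rcases d0 g with d0 | d0 <;>
        rcases d1 g with d1 | d1 <;> linarith
    · have b2 := combinePotential_le_of_ge (ψ 0 + (1 - r) - 1 / 3) (ψ r - 1 / 3) φ h'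
      have g8 := hφ.anti 0 (t - r) le_rfl (by linarith)
      have c3 := hψ.tail r hr0
      have d0 := fun h0 => hφ.tail_of_pos h0 (t := 1 - r) (by linarith)
      have d1 := fun h0 => hφ.tail_of_pos h0 (t := t + (1 - r)) (by linarith)
      have d2 := fun h0 => hφ.tail_of_pos h0 (t := t - r) (by linarith)
      generalize combinePotential (ψ 0 + (1 - r) - 1 / 3) (ψ r - 1 / 3) r φ 0 = u at *
      generalize combinePotential (ψ 0 + (1 - r) - 1 / 3) (ψ r - 1 / 3) r φ t = v at *
      generalize φ (t + (1 - r)) = f2 at *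
      generalize φ (t - r) = f3 at *
      generalize φ (1 - r) = f1 at *
      generalize φ 0 = f at *
      generalize ψ r = c at *
      generalize ψ 0 = d at *
      rcases le_or_gt f 0 with g | g
      · clear d0 d1 d2
        rcases c3 with c3 | c3 | c3 <;> linarith
      · rcases c3 with c3 | c3 | c3 <;>
        rcases d0 g with d0 | d0 <;>
        rcases d1 g with d1 | d1 <;>
        rcases d2 g with d2 | d2 <;> linarith

set_option maxHeartbeats 1000000 in
theorem IsSlackPotential.combine {ψ φ : ℝ → ℝ} (hψ : IsSlackPotential ψ) (hφ : IsPotential φ)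
    {r : ℝ} (hr0 : 0 ≤ r) (hr1 : r ≤ 1) :
    IsSlackPotential (combinePotential (ψ 0 + (1 - r) - 1 / 3) (ψ r - 1 / 3) r φ) := by
  have a1 := combinePotential_zero_le (ψ 0 + (1 - r) - 1 / 3) (ψ r - 1 / 3) r φ
  have a2 := combinePotential_le_of_le (ψ 0 + (1 - r) - 1 / 3) (ψ r - 1 / 3) φ hr0
  have c0 := hψ.zero_le
  have c1 := hψ.anti 0 r le_rfl hr0
  have g0 := hφ.zero_le
  have g1 := hφ.anti 0 (1 - r) le_rfl (by linarith)
  refine .mk (combinePotential_anti hφ.anti _ _ hr1) ?_ ?_ ?_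
  · by_contra hcon
    have c3 := hψ.two_tail r hr0
    have c4 := hψ.tail r hr0
    have d0 := fun h0 => hφ.tail_of_pos h0 (t := 1 - r) (by linarith)
    push Not at hcon
    generalize combinePotential (ψ 0 + (1 - r) - 1 / 3) (ψ r - 1 / 3) r φ 0 = u at *
    generalize φ (1 - r) = f1 at *
    generalize φ 0 = f at *
    generalize ψ r = c at *
    generalize ψ 0 = d at *
    rcases le_or_gt f 0 with g | g
    · clear d0
      rcases c3 with c3 | c3 <;>
      rcases c4 with c4 | c4 <;> linarith
    · rcases c3 with c3 | c3 <;>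
      rcases c4 with c4 | c4 <;>
      rcases d0 g with d0 | d0 <;> linarith
  all_goals
    intro t ht
    have g4 := hφ.anti (1 - r) (t + (1 - r)) (by linarith) (by linarith)
    have b1 := combinePotential_le_left (ψ 0 + (1 - r) - 1 / 3) (ψ r - 1 / 3) r φ t
    by_contra hcon
    push Not at hcon
    obtain ⟨h1, h2⟩ := hcon
    rcases le_total t r with h' | h'
    · have b2 := combinePotential_le_of_le (ψ 0 + (1 - r) - 1 / 3) (ψ r - 1 / 3) φ h'
      have c3 := hψ.two_tail r hr0
      have c4 := hψ.tail r hr0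
      have d0 := fun h0 => hφ.tail_of_pos h0 (t := 1 - r) (by linarith)
      have d1 := fun h0 => hφ.tail_of_pos h0 (t := t + (1 - r)) (by linarith)
      generalize combinePotential (ψ 0 + (1 - r) - 1 / 3) (ψ r - 1 / 3) r φ 0 = u at *
      generalize combinePotential (ψ 0 + (1 - r) - 1 / 3) (ψ r - 1 / 3) r φ t = v at *
      generalize φ (t + (1 - r)) = f2 at *
      generalize φ (1 - r) = f1 at *
      generalize φ 0 = f at *
      generalize ψ r = c at *
      generalize ψ 0 = d at *
      rcases le_or_gt f 0 with g | g
      · clear d0 d1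
        rcases c3 with c3 | c3 <;>
        rcases c4 with c4 | c4 <;> linarith
      · rcases c3 with c3 | c3 <;>
        rcases c4 with c4 | c4 <;>
        rcases d0 g with d0 | d0 <;>
        rcases d1 g with d1 | d1 <;> linarith
    · have b2 := combinePotential_le_of_ge (ψ 0 + (1 - r) - 1 / 3) (ψ r - 1 / 3) φ h'
      have g8 := hφ.anti 0 (t - r) le_rfl (by linarith)
      have c3 := hψ.two_tail r hr0
      have c4 := hψ.tail r hr0
      have d0 := fun h0 => hφ.tail_of_pos h0 (t := 1 - r) (by linarith)
      have d1 := fun h0 => hφ.tail_of_pos h0 (t := t + (1 - r)) (by linarith)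
      have d2 := fun h0 => hφ.tail_of_pos h0 (t := t - r) (by linarith)
      generalize combinePotential (ψ 0 + (1 - r) - 1 / 3) (ψ r - 1 / 3) r φ 0 = u at *
      generalize combinePotential (ψ 0 + (1 - r) - 1 / 3) (ψ r - 1 / 3) r φ t = v at *
      generalize φ (t + (1 - r)) = f2 at *
      generalize φ (t - r) = f3 at *
      generalize φ (1 - r) = f1 at *
      generalize φ 0 = f at *
      generalize ψ r = c at *
      generalize ψ 0 = d at *
      rcases le_or_gt f 0 with g | g
      · clear d0 d1 d2
        rcases c3 with c3 | c3 <;>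
        rcases c4 with c4 | c4 <;> linarith
      · rcases c3 with c3 | c3 <;>
        rcases c4 with c4 | c4 <;>
        rcases d0 g with d0 | d0 <;>
        rcases d1 g with d1 | d1 <;>
        rcases d2 g with d2 | d2 <;> linarith

set_option maxHeartbeats 1000000 in
theorem IsPotential.combine_slack {ψ φ : ℝ → ℝ} (hψ : IsPotential ψ) (hφ : IsSlackPotential φ)
    {r : ℝ} (hr0 : 0 ≤ r) (hr1 : r ≤ 1) :
    IsSlackPotential (combinePotential (ψ 0 + (1 - r) - 1 / 3) (ψ r - 1 / 3) r φ) := by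
  have a1 := combinePotential_zero_le (ψ 0 + (1 - r) - 1 / 3) (ψ r - 1 / 3) r φ
  have a2 := combinePotential_le_of_le (ψ 0 + (1 - r) - 1 / 3) (ψ r - 1 / 3) φ hr0
  have c0 := hψ.zero_le
  have c1 := hψ.anti 0 r le_rfl hr0
  have g0 := hφ.zero_le
  have g1 := hφ.anti 0 (1 - r) le_rfl (by linarith)
  refine .mk (combinePotential_anti hφ.anti _ _ hr1) ?_ ?_ ?_
  · by_contra hcon
    have c3 := hψ.tail r hr0
    have d0 := hφ.two_tail (1 - r) (by linarith)
    have e0 := hφ.tail (1 - r) (by linarith)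
    push Not at hcon
    generalize combinePotential (ψ 0 + (1 - r) - 1 / 3) (ψ r - 1 / 3) r φ 0 = u at *
    generalize φ (1 - r) = f1 at *
    generalize φ 0 = f at *
    generalize ψ r = c at *
    generalize ψ 0 = d at *
    rcases c3 with c3 | c3 | c3 <;>
    rcases d0 with d0 | d0 <;>
    rcases e0 with e0 | e0 <;> linarith
  all_goals
    intro t ht
    have g4 := hφ.anti (1 - r) (t + (1 - r)) (by linarith) (by linarith)
    have b1 := combinePotential_le_left (ψ 0 + (1 - r) - 1 / 3) (ψ r - 1 / 3) r φ t
    by_contra hcon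
    push Not at hcon
    obtain ⟨h1, h2⟩ := hcon
    rcases le_total t r with h' | h'
    · have b2 := combinePotential_le_of_le (ψ 0 + (1 - r) - 1 / 3) (ψ r - 1 / 3) φ h'
      have c3 := hψ.tail r hr0
      have d0 := hφ.two_tail (1 - r) (by linarith)
      have e0 := hφ.tail (1 - r) (by linarith)
      have e1 := hφ.tail (t + (1 - r)) (by linarith)
      generalize combinePotential (ψ 0 + (1 - r) - 1 / 3) (ψ r - 1 / 3) r φ 0 = u at *
      generalize combinePotential (ψ 0 + (1 - r) - 1 / 3) (ψ r - 1 / 3) r φ t = v at *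
      generalize φ (t + (1 - r)) = f2 at *
      generalize φ (1 - r) = f1 at *
      generalize φ 0 = f at *
      generalize ψ r = c at *
      generalize ψ 0 = d at *
      rcases c3 with c3 | c3 | c3 <;>
      rcases d0 with d0 | d0 <;>
      rcases e0 with e0 | e0 <;>
      rcases e1 with e1 | e1 <;> linarith
    · have b2 := combinePotential_le_of_ge (ψ 0 + (1 - r) - 1 / 3) (ψ r - 1 / 3) φ h'
      have g8 := hφ.anti 0 (t - r) le_rfl (by linarith)
      have c3 := hψ.tail r hr0
      have d0 := hφ.two_tail (1 - r) (by linarith)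
      have e0 := hφ.tail (1 - r) (by linarith)
      have e1 := hφ.tail (t + (1 - r)) (by linarith)
      have e2 := hφ.tail (t - r) (by linarith)
      generalize combinePotential (ψ 0 + (1 - r) - 1 / 3) (ψ r - 1 / 3) r φ 0 = u at *
      generalize combinePotential (ψ 0 + (1 - r) - 1 / 3) (ψ r - 1 / 3) r φ t = v at *
      generalize φ (t + (1 - r)) = f2 at *
      generalize φ (t - r) = f3 at *
      generalize φ (1 - r) = f1 at *
      generalize φ 0 = f at *
      generalize ψ r = c at *
      generalize ψ 0 = d at *
      rcases c3 with c3 | c3 | c3 <;>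
      rcases d0 with d0 | d0 <;>
      rcases e0 with e0 | e0 <;>
      rcases e1 with e1 | e1 <;>
      rcases e2 with e2 | e2 <;> linarith

/-- The costs of an item that at least two departed agents hold a part of, where the fraction `r`
remains: `U` if none of them gets the item and `P` if one of them does. -/
def IsCrowdedItem (r U P : ℝ) : Prop :=
  (U ≤ 1 / 3 - r ∧ P ≤ -(1 / 6) - r / 2) ∨
  (U ≤ 1 / 2 - r ∧ P ≤ -(1 / 4) - r / 2) ∨
  (U ≤ 2 / 3 - r ∧ P ≤ -(1 / 3) - r / 2) ∨
  ∃ w, 0 ≤ w ∧ w ≤ 1 / 6 ∧ U ≤ 1 / 2 + w - r ∧ P ≤ -(1 / 6) - w - r ∧ P ≤ w - 1 / 4 - r / 2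

set_option maxHeartbeats 1000000 in
theorem IsCrowdedItem.combine {r U P : ℝ} (h : IsCrowdedItem r U P) {φ : ℝ → ℝ}
    (hφ : IsPotential φ) (hr0 : 0 ≤ r) (hr1 : r ≤ 1) :
    IsSlackPotential (combinePotential U P r φ) := by
  have a1 := combinePotential_zero_le U P r φ
  have a2 := combinePotential_le_of_le U P φ hr0
  have g0 := hφ.zero_le
  have g1 := hφ.anti 0 (1 - r) le_rfl (by linarith)
  refine .mk (combinePotential_anti hφ.anti _ _ hr1) ?_ ?_ ?_
  · by_contra hcon
    have d0 := fun h0 => hφ.tail_of_pos h0 (t := 1 - r) (by linarith)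
    push Not at hcon
    generalize combinePotential U P r φ 0 = u at *
    generalize φ (1 - r) = f1 at *
    generalize φ 0 = f at *
    rcases le_or_gt f 0 with g | g
    · clear d0
      rcases h with ⟨hU, hP⟩ | ⟨hU, hP⟩ | ⟨hU, hP⟩ | ⟨w, hw0, hw1, hU, hP, hP'⟩ <;> linarith
    · rcases h with ⟨hU, hP⟩ | ⟨hU, hP⟩ | ⟨hU, hP⟩ | ⟨w, hw0, hw1, hU, hP, hP'⟩ <;>
      rcases d0 g with d0 | d0 <;> linarith
  all_goals
    intro t ht
    have g4 := hφ.anti (1 - r) (t + (1 - r)) (by linarith) (by linarith)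
    have b1 := combinePotential_le_left U P r φ t
    by_contra hcon
    push Not at hcon
    obtain ⟨h1, h2⟩ := hcon
    rcases le_total t r with h' | h'
    · have b2 := combinePotential_le_of_le U P φ h'
      have d0 := fun h0 => hφ.tail_of_pos h0 (t := 1 - r) (by linarith)
      have d1 := fun h0 => hφ.tail_of_pos h0 (t := t + (1 - r)) (by linarith)
      generalize combinePotential U P r φ 0 = u at *
      generalize combinePotential U P r φ t = v at *
      generalize φ (t + (1 - r)) = f2 at *
      generalize φ (1 - r) = f1 at *
      generalize φ 0 = f at *
      rcases le_or_gt f 0 with g | g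
      · clear d0 d1
        rcases h with ⟨hU, hP⟩ | ⟨hU, hP⟩ | ⟨hU, hP⟩ | ⟨w, hw0, hw1, hU, hP, hP'⟩ <;> linarith
      · rcases h with ⟨hU, hP⟩ | ⟨hU, hP⟩ | ⟨hU, hP⟩ | ⟨w, hw0, hw1, hU, hP, hP'⟩ <;>
        rcases d0 g with d0 | d0 <;>
        rcases d1 g with d1 | d1 <;> linarith
    · have b2 := combinePotential_le_of_ge U P φ h'
      have g8 := hφ.anti 0 (t - r) le_rfl (by linarith)
      have d0 := fun h0 => hφ.tail_of_pos h0 (t := 1 - r) (by linarith)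
      have d1 := fun h0 => hφ.tail_of_pos h0 (t := t + (1 - r)) (by linarith)
      have d2 := fun h0 => hφ.tail_of_pos h0 (t := t - r) (by linarith)
      generalize combinePotential U P r φ 0 = u at *
      generalize combinePotential U P r φ t = v at *
      generalize φ (t + (1 - r)) = f2 at *
      generalize φ (t - r) = f3 at *
      generalize φ (1 - r) = f1 at *
      generalize φ 0 = f at *
      rcases le_or_gt f 0 with g | g
      · clear d0 d1 d2
        rcases h with ⟨hU, hP⟩ | ⟨hU, hP⟩ | ⟨hU, hP⟩ | ⟨w, hw0, hw1, hU, hP, hP'⟩ <;> linarith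
      · rcases h with ⟨hU, hP⟩ | ⟨hU, hP⟩ | ⟨hU, hP⟩ | ⟨w, hw0, hw1, hU, hP, hP'⟩ <;>
        rcases d0 g with d0 | d0 <;>
        rcases d1 g with d1 | d1 <;>
        rcases d2 g with d2 | d2 <;> linarith

theorem IsCrowdedItem.of_two {ψ φ : ℝ → ℝ} (hψ : IsPotential ψ) (hφ : IsPotential φ) {r a : ℝ}
    (ha0 : 0 ≤ a) (har : a ≤ r) (hr1 : r ≤ 1) :
    IsCrowdedItem (r - a) ((ψ 0 + (1 - r) - 1 / 3) + φ 0 + a - 1 / 3)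
      (min ((ψ r - 1 / 3) + φ 0 + a) ((ψ 0 + (1 - r) - 1 / 3) + φ (1 - a)) - 1 / 3) := by
  have b1 := min_le_left ((ψ r - 1 / 3) + φ 0 + a) ((ψ 0 + (1 - r) - 1 / 3) + φ (1 - a))
  have b2 := min_le_right ((ψ r - 1 / 3) + φ 0 + a) ((ψ 0 + (1 - r) - 1 / 3) + φ (1 - a))
  have c0 := hψ.zero_le
  have c1 := hψ.anti 0 r le_rfl (by linarith)
  have g0 := hφ.zero_le
  have g1 := hφ.anti 0 (1 - a) le_rfl (by linarith)
  have c2 := hψ.tail r (by linarith)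
  have g2 := hφ.tail (1 - a) (by linarith)
  rcases le_or_gt (ψ 0) 0 with hc | hc <;> rcases le_or_gt (φ 0) 0 with hg | hg
  · exact Or.inl ⟨by linarith, by linarith⟩
  · refine Or.inr (Or.inl ⟨by linarith, ?_⟩)
    rcases g2 with g2 | g2 | g2 <;> linarith
  · refine Or.inr (Or.inl ⟨by linarith, ?_⟩)
    rcases c2 with c2 | c2 | c2 <;> linarith
  · rcases c2 with c2 | c2 | c2
    · linarith
    · rcases g2 with g2 | g2 | g2
      · linarith
      · exact Or.inr (Or.inr (Or.inl ⟨by linarith, by linarith⟩))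
      · exact Or.inr (Or.inr (Or.inr ⟨φ 0, hg.le, g0, by linarith, by linarith, by linarith⟩))
    · rcases g2 with g2 | g2 | g2
      · linarith
      · exact Or.inr (Or.inr (Or.inr ⟨ψ 0, hc.le, c0, by linarith, by linarith, by linarith⟩))
      · exact Or.inr (Or.inr (Or.inl ⟨by linarith, by linarith⟩))

theorem IsCrowdedItem.depart {r U P : ℝ} (h : IsCrowdedItem r U P) {φ : ℝ → ℝ}
    (hφ : IsPotential φ) {a : ℝ} (ha0 : 0 ≤ a) (har : a ≤ r) (hr1 : r ≤ 1) :
    IsCrowdedItem (r - a) (U + φ 0 + a - 1 / 3) (min (P + φ 0 + a) (U + φ (1 - a)) - 1 / 3) := by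
  have b1 := min_le_left (P + φ 0 + a) (U + φ (1 - a))
  have b2 := min_le_right (P + φ 0 + a) (U + φ (1 - a))
  have g0 := hφ.zero_le
  have g1 := hφ.anti 0 (1 - a) le_rfl (by linarith)
  have g2 := hφ.tail (1 - a) (by linarith)
  rcases h with ⟨hU, hP⟩ | ⟨hU, hP⟩ | ⟨hU, hP⟩ | ⟨w, hw0, hw1, hU, hP, hP'⟩
  · refine Or.inl ⟨by linarith, ?_⟩
    by_contra hcon
    rcases g2 with g2 | g2 | g2 <;> linarith
  · refine Or.inl ⟨by linarith, ?_⟩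
    rcases g2 with g2 | g2 | g2 <;> linarith
  · refine Or.inr (Or.inl ⟨by linarith, ?_⟩)
    rcases g2 with g2 | g2 | g2 <;> linarith
  · refine Or.inr (Or.inl ⟨by linarith, ?_⟩)
    rcases g2 with g2 | g2 | g2 <;> linarith

theorem Finset.sum_apply_update {ι α : Type*} [DecidableEq ι] {S : Finset ι} {i : ι} (hi : i ∈ S)
    (φ : ι → α → ℝ) (τ : ι → α) (t : α) :
    ∑ k ∈ S, φ k (Function.update τ i t k) = φ i t + ∑ k ∈ S.erase i, φ k (τ k) := by
  rw [← add_sum_erase _ _ hi, Function.update_self]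
  congr 1
  exact sum_congr rfl fun k hk => by rw [Function.update_of_ne (ne_of_mem_erase hk)]

theorem FracAllocation.set_self (x : FracAllocation n m) (i : Fin n) (e : Fin m) (a : ℝ) :
    x.set i e a i e = a := by
  simp [FracAllocation.set]

theorem FracAllocation.set_of_ne_item (x : FracAllocation n m) (i k : Fin n) {e e' : Fin m} (a : ℝ)
    (h : e' ≠ e) : x.set i e a k e' = x k e' := by
  by_cases hk : k = i
  · subst hk; simp [FracAllocation.set, h]
  · simp [FracAllocation.set, hk]

theorem FracAllocation.set_of_ne_agent (x : FracAllocation n m) {i k : Fin n} (e : Fin m) (a : ℝ)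
    (h : k ≠ i) : x.set i e a k = x k := by
  simp [FracAllocation.set, h]

theorem FracAllocation.sum_set (x : FracAllocation n m) {i : Fin n} {e : Fin m} (a : ℝ)
    (h : x i e = 0) : ∑ k, x.set i e a k e = ∑ k, x k e + a := by
  have : ∀ k, x.set i e a k e = x k e + if k = i then a else 0 := by
    intro k
    by_cases hk : k = i
    · subst hk; simp [FracAllocation.set_self, h]
    · simp [FracAllocation.set_of_ne_agent x e a hk, hk]
  simp [this, sum_add_distrib]

theorem GoodsInstance.fracValue_set (I : GoodsInstance n m) (x : FracAllocation n m) {i : Fin n}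
    {e : Fin m} (a : ℝ) (h : x i e = 0) :
    I.fracValue i (x.set i e a i) = I.fracValue i (x i) + a * I.v i e := by
  have : ∀ e', x.set i e a i e' * I.v i e' = x i e' * I.v i e' + if e' = e then a * I.v i e else 0 := by
    intro e'
    by_cases he : e' = e
    · subst he; simp [FracAllocation.set_self, h]
    · simp [FracAllocation.set_of_ne_item x i i a he, he]
  simp [GoodsInstance.fracValue, this, sum_add_distrib]

/-- The state after agent `i` has taken all that remains of the current item `e`. -/
def FBTAState.takeItem (s : FBTAState n m) (e : Fin m) (i : Fin n) : FBTAState n m where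
  x := s.x.set i e (s.z e)
  active := s.active
  z := Function.update s.z e 0
  j := s.j + 1

theorem FBTAState.takeItem_x (s : FBTAState n m) (e : Fin m) (i : Fin n) :
    (s.takeItem e i).x = s.x.set i e (s.z e) :=
  rfl

/-- The state after agent `i` has taken the amount `a` of the current item `e` and departed. -/
def FBTAState.depart (s : FBTAState n m) (e : Fin m) (i : Fin n) (a : ℝ) : FBTAState n m where
  x := s.x.set i e a
  active := s.active.erase i
  z := Function.update s.z e (s.z e - a)
  j := s.j

/-- The state after agent `k` has taken all that remains of all items. -/
def FBTAState.finish (s : FBTAState n m) (k : Fin n) : FBTAState n m where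
  x := Function.update s.x k (fun e => s.x k e + s.z e)
  active := {k}
  z := fun _ => 0
  j := m

/-- The items before the current one are completely allocated, those after it are untouched, and
the departed agents have received exactly their shares. -/
structure GoodsInstance.Consistent (I : GoodsInstance n m) (s : FBTAState n m) : Prop where
  j_le : s.j ≤ m
  x_nonneg : ∀ i e, 0 ≤ s.x i e
  sum_add : ∀ e, ∑ i, s.x i e + s.z e = 1
  z_of_lt : ∀ e : Fin m, (e : ℕ) < s.j → s.z e = 0
  z_of_gt : ∀ e : Fin m, s.j < e → s.z e = 1
  z_pos : ∀ e : Fin m, s.j = e → 0 < s.z e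
  active_zero : ∀ i ∈ s.active, ∀ e : Fin m, s.j ≤ e → s.x i e = 0
  departed : ∀ i ∉ s.active, I.fracValue i (s.x i) = I.share i

theorem GoodsInstance.Consistent.z_le_one {I : GoodsInstance n m} {s : FBTAState n m}
    (h : I.Consistent s) (e : Fin m) : s.z e ≤ 1 := by
  have := h.sum_add e
  have := sum_nonneg fun i (_ : i ∈ (univ : Finset (Fin n))) => h.x_nonneg i e
  linarith

theorem GoodsInstance.Consistent.x_eq_zero {I : GoodsInstance n m} {s : FBTAState n m}
    (h : I.Consistent s) {e : Fin m} (he : s.z e = 1) (i : Fin n) : s.x i e = 0 := by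
  have h1 := h.sum_add e
  have h2 : ∑ i, s.x i e = 0 := by linarith
  exact (sum_eq_zero_iff_of_nonneg fun i _ => h.x_nonneg i e).1 h2 i (mem_univ i)

theorem GoodsInstance.Consistent.takeItem {I : GoodsInstance n m} {s : FBTAState n m}
    (h : I.Consistent s) {e : Fin m} {i : Fin n} (he : s.j = e) (hi : i ∈ s.active) :
    I.Consistent (s.takeItem e i) where
  j_le := by have := e.2; simp only [FBTAState.takeItem]; omega
  x_nonneg k e' := by
    simp only [FBTAState.takeItem]
    by_cases h1 : e' = e
    · subst h1
      by_cases h2 : k = i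
      · subst h2; rw [FracAllocation.set_self]; exact (h.z_pos _ he).le
      · rw [FracAllocation.set_of_ne_agent _ _ _ h2]; exact h.x_nonneg k e'
    · rw [FracAllocation.set_of_ne_item _ _ _ _ h1]; exact h.x_nonneg k e'
  sum_add e' := by
    simp only [FBTAState.takeItem]
    by_cases h1 : e' = e
    · subst h1
      rw [FracAllocation.sum_set _ _ (h.active_zero i hi _ he.le), Function.update_self]
      linarith [h.sum_add e']
    · simp only [FracAllocation.set_of_ne_item _ _ _ _ h1, Function.update_of_ne h1]
      exact h.sum_add e'
  z_of_lt e' h' := by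
    simp only [FBTAState.takeItem] at h' ⊢
    by_cases h1 : e' = e
    · subst h1; simp
    · rw [Function.update_of_ne h1]
      have : (e' : ℕ) ≠ e := fun hh => h1 (Fin.ext hh)
      exact h.z_of_lt e' (by omega)
  z_of_gt e' h' := by
    simp only [FBTAState.takeItem] at h' ⊢
    have h1 : e' ≠ e := by rintro rfl; omega
    rw [Function.update_of_ne h1]
    exact h.z_of_gt e' (by omega)
  z_pos e' h' := by
    simp only [FBTAState.takeItem] at h' ⊢
    have h1 : e' ≠ e := by rintro rfl; omega
    rw [Function.update_of_ne h1, h.z_of_gt e' (by omega)]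
    exact one_pos
  active_zero k hk e' h' := by
    simp only [FBTAState.takeItem] at h' hk ⊢
    have h1 : e' ≠ e := by rintro rfl; omega
    rw [FracAllocation.set_of_ne_item _ _ _ _ h1]
    exact h.active_zero k hk e' (by omega)
  departed k hk := by
    simp only [FBTAState.takeItem] at hk ⊢
    have : k ≠ i := by rintro rfl; exact hk hi
    rw [FracAllocation.set_of_ne_agent _ _ _ this]
    exact h.departed k hk

theorem GoodsInstance.Consistent.depart {I : GoodsInstance n m} {s : FBTAState n m}
    (h : I.Consistent s) {e : Fin m} {i : Fin n} {a : ℝ} (he : s.j = e) (hi : i ∈ s.active)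
    (ha0 : 0 ≤ a) (haz : a < s.z e)
    (hfill : I.fracValue i (s.x i) + a * I.v i e = I.share i) :
    I.Consistent (s.depart e i a) where
  j_le := h.j_le
  x_nonneg k e' := by
    simp only [FBTAState.depart]
    by_cases h1 : e' = e
    · subst h1
      by_cases h2 : k = i
      · subst h2; rw [FracAllocation.set_self]; exact ha0
      · rw [FracAllocation.set_of_ne_agent _ _ _ h2]; exact h.x_nonneg k e'
    · rw [FracAllocation.set_of_ne_item _ _ _ _ h1]; exact h.x_nonneg k e'
  sum_add e' := by
    simp only [FBTAState.depart]
    by_cases h1 : e' = e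
    · subst h1
      rw [FracAllocation.sum_set _ _ (h.active_zero i hi _ he.le), Function.update_self]
      linarith [h.sum_add e']
    · simp only [FracAllocation.set_of_ne_item _ _ _ _ h1, Function.update_of_ne h1]
      exact h.sum_add e'
  z_of_lt e' h' := by
    simp only [FBTAState.depart] at h' ⊢
    have h1 : e' ≠ e := by rintro rfl; omega
    rw [Function.update_of_ne h1]
    exact h.z_of_lt e' h'
  z_of_gt e' h' := by
    simp only [FBTAState.depart] at h' ⊢
    have h1 : e' ≠ e := by rintro rfl; omega
    rw [Function.update_of_ne h1]
    exact h.z_of_gt e' h'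
  z_pos e' h' := by
    simp only [FBTAState.depart] at h' ⊢
    have h1 : e' = e := Fin.ext (by omega)
    subst h1
    rw [Function.update_self]
    linarith
  active_zero k hk e' h' := by
    simp only [FBTAState.depart, mem_erase] at h' hk ⊢
    rw [FracAllocation.set_of_ne_agent _ _ _ hk.1]
    exact h.active_zero k hk.2 e' h'
  departed k hk := by
    simp only [FBTAState.depart, mem_erase, not_and_or, not_not] at hk ⊢
    by_cases hki : k = i
    · subst hki
      rw [I.fracValue_set _ _ (h.active_zero k hi _ he.le), hfill]
    · rw [FracAllocation.set_of_ne_agent _ _ _ hki]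
      exact h.departed k (hk.resolve_left hki)

/-- The value for agent `i` of those of the first `J` items that `o` assigns to her. -/
noncomputable def GoodsInstance.ownValue (I : GoodsInstance n m) (o : Fin m → Fin n) (J : ℕ)
    (i : Fin n) : ℝ :=
  ∑ e : Fin m, if (e : ℕ) < J ∧ o e = i then I.v i e else 0

theorem GoodsInstance.ownValue_update (I : GoodsInstance n m) (o : Fin m → Fin n) {J : ℕ}
    {e : Fin m} (he : J = e) (g i : Fin n) :
    I.ownValue (Function.update o e g) (J + 1) i =
      I.ownValue o J i + if g = i then I.v i e else 0 := by
  have : ∀ e' : Fin m, (if (e' : ℕ) < J + 1 ∧ Function.update o e g e' = i then I.v i e' else 0) =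
      (if (e' : ℕ) < J ∧ o e' = i then I.v i e' else 0) +
        if e' = e then (if g = i then I.v i e else 0) else 0 := by
    intro e'
    by_cases h1 : e' = e
    · subst h1; simp [he]
    · have h2 : (e' : ℕ) ≠ e := fun hh => h1 (Fin.ext hh)
      have h3 : (e' : ℕ) < J + 1 ↔ (e' : ℕ) < J := by omega
      simp [h1, h3]
  simp only [GoodsInstance.ownValue, this, sum_add_distrib, sum_ite_eq', mem_univ, if_true]

/-- `o` assigns the first `J` items to agents who hold a positive fraction of them, so that the
departed agents reach their shares with the subsidies `σ`, and the active agents fall short of their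
fractional values by at most `σ i + τ i` times any bound on the values of the items so far. -/
structure GoodsInstance.PartialRounding (I : GoodsInstance n m) (s : FBTAState n m) (J : ℕ)
    (τ σ : Fin n → ℝ) (o : Fin m → Fin n) : Prop where
  pos : ∀ e : Fin m, (e : ℕ) < J → 0 < s.x (o e) e
  nonneg : ∀ i, 0 ≤ σ i
  departed : ∀ i ∉ s.active, I.share i ≤ I.ownValue o J i + σ i
  active : ∀ i ∈ s.active, ∀ c, 0 ≤ c → (∀ e : Fin m, (e : ℕ) < s.j → I.v i e ≤ c) →
    I.fracValue i (s.x i) ≤ I.ownValue o J i + (σ i + τ i) * c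

/-- For all `τ`, the first `J` items have a partial rounding with total subsidy at most `B` plus the
potentials of the active agents. -/
def GoodsInstance.HasRoundings (I : GoodsInstance n m) (s : FBTAState n m) (J : ℕ) (B : ℝ)
    (φ : Fin n → ℝ → ℝ) : Prop :=
  ∀ τ : Fin n → ℝ, (∀ i, 0 ≤ τ i) → ∃ (o : Fin m → Fin n) (σ : Fin n → ℝ),
    I.PartialRounding s J τ σ o ∧ ∑ i, σ i ≤ B + ∑ i ∈ s.active, φ i (τ i)

theorem GoodsInstance.HasRoundings.mono {I : GoodsInstance n m} {s : FBTAState n m} {J : ℕ}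
    {B B' : ℝ} {φ φ' : Fin n → ℝ → ℝ} (h : I.HasRoundings s J B φ)
    (hB : ∀ τ : Fin n → ℝ, B + ∑ i ∈ s.active, φ i (τ i) ≤ B' + ∑ i ∈ s.active, φ' i (τ i)) :
    I.HasRoundings s J B' φ' := fun τ hτ =>
  let ⟨o, σ, h1, h2⟩ := h τ hτ
  ⟨o, σ, h1, h2.trans (hB τ)⟩

theorem GoodsInstance.HasRoundings.takeItem_of_whole {I : GoodsInstance n m} {s : FBTAState n m}
    (hs : I.Consistent s) {e : Fin m} {g : Fin n} (he : s.j = e) (hg : g ∈ s.active)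
    (hz : s.z e = 1) {B : ℝ} {φ : Fin n → ℝ → ℝ} (h : I.HasRoundings s s.j B φ) :
    I.HasRoundings (s.takeItem e g) (s.j + 1) B φ := by
  intro τ hτ
  obtain ⟨o, σ, h1, h2⟩ := h τ hτ
  refine ⟨Function.update o e g, σ, ⟨fun e' he' => ?_, h1.nonneg, fun i hi => ?_,
    fun i hi c hc0 hc => ?_⟩, h2⟩
  · simp only [FBTAState.takeItem]
    by_cases h3 : e' = e
    · subst h3; rw [Function.update_self, FracAllocation.set_self, hz]; exact one_pos
    · rw [Function.update_of_ne h3, FracAllocation.set_of_ne_item _ _ _ _ h3]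
      have : (e' : ℕ) ≠ e := fun hh => h3 (Fin.ext hh)
      exact h1.pos e' (by omega)
  · simp only [FBTAState.takeItem] at hi
    have : g ≠ i := by rintro rfl; exact hi hg
    rw [I.ownValue_update o he, if_neg this, add_zero]
    exact h1.departed i hi
  · simp only [FBTAState.takeItem] at hi hc ⊢
    have h3 := h1.active i hi c hc0 fun e' he' => hc e' (by omega)
    rw [I.ownValue_update o he]
    by_cases hgi : g = i
    · subst hgi
      rw [I.fracValue_set _ _ (hs.active_zero g hg _ he.le), hz, if_pos rfl]
      linarith
    · rw [FracAllocation.set_of_ne_agent _ _ _ (Ne.symm hgi), if_neg hgi, add_zero]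
      exact h3

theorem GoodsInstance.HasRoundings.takeItem {I : GoodsInstance n m} (hI : I.IsIDO)
    {s : FBTAState n m}
    (hs : I.Consistent s) {e : Fin m} {g : Fin n} (he : s.j = e) (hg : g ∈ s.active)
    {B U P : ℝ} {φ : Fin n → ℝ → ℝ} (hU : I.HasRoundings s s.j (B + U) φ)
    (hP : I.HasRoundings s (s.j + 1) (B + P) φ) :
    I.HasRoundings (s.takeItem e g) (s.j + 1) B
      (Function.update φ g (combinePotential U P (s.z e) (φ g))) := by
  intro τ hτ
  have hz0 := hs.z_pos e he
  have hz1 := hs.z_le_one e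
  have hsum := sum_apply_update hg φ τ
  have hsum' := sum_apply_update hg (fun k f => f (τ k)) φ (combinePotential U P (s.z e) (φ g))
  have hact : (s.takeItem e g).active = s.active := rfl
  rw [hact, hsum']
  rcases min_choice (U + φ g (τ g + (1 - s.z e)))
    (P + φ g (max (τ g - s.z e) 0) + max (s.z e - τ g) 0) with hmin | hmin
  · obtain ⟨o, σ, h1, h2⟩ := hU (Function.update τ g (τ g + (1 - s.z e))) (by
      intro i
      by_cases hi : i = g
      · subst hi; rw [Function.update_self]; linarith [hτ i]
      · rw [Function.update_of_ne hi]; exact hτ i)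
    refine ⟨Function.update o e g, σ, ⟨fun e' he' => ?_, h1.nonneg, fun i hi => ?_,
      fun i hi c hc0 hc => ?_⟩, ?_⟩
    · simp only [FBTAState.takeItem]
      by_cases h3 : e' = e
      · subst h3; rw [Function.update_self, FracAllocation.set_self]; exact hz0
      · rw [Function.update_of_ne h3, FracAllocation.set_of_ne_item _ _ _ _ h3]
        have : (e' : ℕ) ≠ e := fun hh => h3 (Fin.ext hh)
        exact h1.pos e' (by omega)
    · simp only [FBTAState.takeItem] at hi
      have : g ≠ i := by rintro rfl; exact hi hg
      rw [I.ownValue_update o he, if_neg this, add_zero]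
      exact h1.departed i hi
    · simp only [FBTAState.takeItem] at hi hc ⊢
      rw [I.ownValue_update o he]
      by_cases hgi : g = i
      · subst hgi
        have h3 := h1.active g hi (I.v g e) (I.v_nonneg g e) fun e' he' =>
          hI g (Fin.le_def.2 (by omega))
        rw [Function.update_self] at h3
        rw [I.fracValue_set _ _ (hs.active_zero g hg _ he.le), if_pos rfl]
        have h4 : (σ g + τ g) * I.v g e ≤ (σ g + τ g) * c :=
          mul_le_mul_of_nonneg_left (hc e (by omega)) (add_nonneg (h1.nonneg g) (hτ g))
        linarith
      · have h3 := h1.active i hi c hc0 fun e' he' => hc e' (by omega)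
        rw [Function.update_of_ne (Ne.symm hgi)] at h3
        rw [FracAllocation.set_of_ne_agent _ _ _ (Ne.symm hgi), if_neg hgi, add_zero]
        exact h3
    · rw [hsum] at h2
      rw [combinePotential, hmin]
      linarith
  · obtain ⟨o, σ, h1, h2⟩ := hP (Function.update τ g (max (τ g - s.z e) 0)) (by
      intro i
      by_cases hi : i = g
      · subst hi; rw [Function.update_self]; exact le_max_right _ _
      · rw [Function.update_of_ne hi]; exact hτ i)
    have hσ : ∑ i, Function.update σ g (σ g + max (s.z e - τ g) 0) i =
        ∑ i, σ i + max (s.z e - τ g) 0 := by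
      rw [sum_apply_update (mem_univ g) (fun _ t => t), ← add_sum_erase _ σ (mem_univ g)]
      ring
    refine ⟨o, Function.update σ g (σ g + max (s.z e - τ g) 0), ⟨fun e' he' => ?_, fun i => ?_,
      fun i hi => ?_, fun i hi c hc0 hc => ?_⟩, ?_⟩
    · have h4 := h1.pos e' he'
      simp only [FBTAState.takeItem]
      by_cases h3 : e' = e
      · subst h3
        have : o e' ≠ g := fun hh => by
          rw [hh, hs.active_zero g hg _ he.le] at h4; exact lt_irrefl _ h4
        rw [FracAllocation.set_of_ne_agent _ _ _ this]; exact h4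
      · rw [FracAllocation.set_of_ne_item _ _ _ _ h3]; exact h4
    · by_cases hi : i = g
      · subst hi
        rw [Function.update_self]
        exact add_nonneg (h1.nonneg i) (le_max_right _ _)
      · rw [Function.update_of_ne hi]; exact h1.nonneg i
    · simp only [FBTAState.takeItem] at hi
      have : i ≠ g := by rintro rfl; exact hi hg
      rw [Function.update_of_ne this]
      exact h1.departed i hi
    · simp only [FBTAState.takeItem] at hi hc ⊢
      have h3 := h1.active i hi c hc0 fun e' he' => hc e' (by omega)
      by_cases hgi : i = g
      · subst hgi
        rw [Function.update_self] at h3 ⊢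
        rw [I.fracValue_set _ _ (hs.active_zero i hg _ he.le)]
        have h4 : s.z e * I.v i e ≤ s.z e * c :=
          mul_le_mul_of_nonneg_left (hc e (by omega)) hz0.le
        have h5 : max (s.z e - τ i) 0 + τ i = max (τ i - s.z e) 0 + s.z e := by
          rcases le_total (τ i) (s.z e) with h6 | h6
          · rw [max_eq_left (by linarith), max_eq_right (by linarith)]; ring
          · rw [max_eq_right (by linarith), max_eq_left (by linarith)]; ring
        have h6 : σ i + max (s.z e - τ i) 0 + τ i = σ i + max (τ i - s.z e) 0 + s.z e := by
          linarith
        rw [h6]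
        linarith
      · rw [Function.update_of_ne hgi] at h3 ⊢
        rw [FracAllocation.set_of_ne_agent _ _ _ hgi]
        exact h3
    · rw [hsum] at h2
      rw [combinePotential, hmin, hσ]
      linarith

theorem GoodsInstance.HasRoundings.depart {I : GoodsInstance n m} {s : FBTAState n m}
    (hs : I.Consistent s) {e : Fin m} {i : Fin n} {a : ℝ} (he : s.j = e) (hi : i ∈ s.active)
    (ha0 : 0 ≤ a) (hfill : I.fracValue i (s.x i) + a * I.v i e = I.share i) {J : ℕ} {B : ℝ}
    {φ : Fin n → ℝ → ℝ} (h : I.HasRoundings s J B φ) :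
    I.HasRoundings (s.depart e i a) J (B + φ i 0 + a) φ := by
  intro τ hτ
  obtain ⟨o, σ, h1, h2⟩ := h (Function.update τ i 0) (by
    intro k
    by_cases hk : k = i
    · subst hk; rw [Function.update_self]
    · rw [Function.update_of_ne hk]; exact hτ k)
  have hσ : ∑ k, Function.update σ i (σ i + a) k = ∑ k, σ k + a := by
    rw [sum_apply_update (mem_univ i) (fun _ t => t), ← add_sum_erase _ σ (mem_univ i)]
    ring
  rw [sum_apply_update hi] at h2
  refine ⟨o, Function.update σ i (σ i + a), ⟨fun e' he' => ?_, fun k => ?_,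
    fun k hk => ?_, fun k hk c hc0 hc => ?_⟩, ?_⟩
  · have h4 := h1.pos e' he'
    simp only [FBTAState.depart]
    by_cases h3 : e' = e
    · subst h3
      have : o e' ≠ i := fun hh => by
        rw [hh, hs.active_zero i hi _ he.le] at h4; exact lt_irrefl _ h4
      rw [FracAllocation.set_of_ne_agent _ _ _ this]; exact h4
    · rw [FracAllocation.set_of_ne_item _ _ _ _ h3]; exact h4
  · by_cases hk : k = i
    · subst hk
      rw [Function.update_self]
      exact add_nonneg (h1.nonneg k) ha0
    · rw [Function.update_of_ne hk]; exact h1.nonneg k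
  · by_cases hki : k = i
    · subst hki
      have h3 := h1.active k hi 1 zero_le_one fun e' _ => I.v_le_one k e'
      rw [Function.update_self] at h3 ⊢
      have h4 : a * I.v k e ≤ a * 1 := mul_le_mul_of_nonneg_left (I.v_le_one k e) ha0
      linarith
    · simp only [FBTAState.depart, mem_erase, not_and_or, not_not] at hk
      rw [Function.update_of_ne hki]
      exact h1.departed k (hk.resolve_left hki)
  · simp only [FBTAState.depart, mem_erase] at hk hc ⊢
    have h3 := h1.active k hk.2 c hc0 hc
    rw [Function.update_of_ne hk.1] at h3 ⊢
    rw [FracAllocation.set_of_ne_agent _ _ _ hk.1]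
    exact h3
  · have hact : (s.depart e i a).active = s.active.erase i := rfl
    rw [hσ, hact]
    linarith

theorem GoodsInstance.HasRoundings.depart_own {I : GoodsInstance n m} (hI : I.IsIDO)
    {s : FBTAState n m}
    {e : Fin m} {i : Fin n} {a : ℝ} (he : s.j = e) (hi : i ∈ s.active)
    (ha0 : 0 < a) (ha1 : a ≤ 1) (hfill : I.fracValue i (s.x i) + a * I.v i e = I.share i) {B : ℝ}
    {φ : Fin n → ℝ → ℝ} (h : I.HasRoundings s s.j B φ) :
    I.HasRoundings (s.depart e i a) (s.j + 1) (B + φ i (1 - a)) φ := by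
  intro τ hτ
  obtain ⟨o, σ, h1, h2⟩ := h (Function.update τ i (1 - a)) (by
    intro k
    by_cases hk : k = i
    · subst hk; rw [Function.update_self]; linarith
    · rw [Function.update_of_ne hk]; exact hτ k)
  rw [sum_apply_update hi] at h2
  refine ⟨Function.update o e i, σ, ⟨fun e' he' => ?_, h1.nonneg,
    fun k hk => ?_, fun k hk c hc0 hc => ?_⟩, ?_⟩
  · simp only [FBTAState.depart]
    by_cases h3 : e' = e
    · subst h3
      rw [Function.update_self, FracAllocation.set_self]; exact ha0
    · rw [Function.update_of_ne h3, FracAllocation.set_of_ne_item _ _ _ _ h3]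
      have : (e' : ℕ) ≠ e := fun hh => h3 (Fin.ext hh)
      exact h1.pos e' (by omega)
  · rw [I.ownValue_update o he]
    by_cases hki : k = i
    · subst hki
      have h3 := h1.active k hi (I.v k e) (I.v_nonneg k e) fun e' he' =>
          hI k (Fin.le_def.2 (by omega))
      rw [Function.update_self] at h3
      rw [if_pos rfl]
      have h4 : σ k * I.v k e ≤ σ k * 1 :=
        mul_le_mul_of_nonneg_left (I.v_le_one k e) (h1.nonneg k)
      linarith
    · simp only [FBTAState.depart, mem_erase, not_and_or, not_not] at hk
      rw [if_neg (Ne.symm hki), add_zero]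
      exact h1.departed k (hk.resolve_left hki)
  · simp only [FBTAState.depart, mem_erase] at hk hc ⊢
    have h3 := h1.active k hk.2 c hc0 hc
    rw [Function.update_of_ne hk.1] at h3
    rw [FracAllocation.set_of_ne_agent _ _ _ hk.1, I.ownValue_update o he,
      if_neg (Ne.symm hk.1), add_zero]
    exact h3
  · have hact : (s.depart e i a).active = s.active.erase i := rfl
    rw [hact]
    linarith

theorem FracAllocation.mem_holders {x : FracAllocation n m} {e : Fin m} {i : Fin n} :
    i ∈ x.holders e ↔ 0 < x i e := by
  simp [FracAllocation.holders]

theorem FracAllocation.mem_fractionalItems {x : FracAllocation n m} {e : Fin m} :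
    e ∈ x.fractionalItems ↔ 2 ≤ (x.holders e).card := by
  simp [FracAllocation.fractionalItems]

theorem FracAllocation.holders_set_of_ne (x : FracAllocation n m) (i : Fin n) {e e' : Fin m} (a : ℝ)
    (h : e' ≠ e) : (x.set i e a).holders e' = x.holders e' := by
  ext k
  rw [FracAllocation.mem_holders, FracAllocation.mem_holders, FracAllocation.set_of_ne_item _ _ _ _ h]

/-- The fractional items among those that are completely allocated. -/
noncomputable def FBTAState.fracDone (s : FBTAState n m) : Finset (Fin m) :=
  {e | e ∈ s.x.fractionalItems ∧ (e : ℕ) < s.j}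

theorem FBTAState.mem_fracDone {s : FBTAState n m} {e : Fin m} :
    e ∈ s.fracDone ↔ 2 ≤ (s.x.holders e).card ∧ (e : ℕ) < s.j := by
  simp [FBTAState.fracDone, FracAllocation.mem_fractionalItems]

theorem FBTAState.fracDone_depart (s : FBTAState n m) {e : Fin m} (i : Fin n) (a : ℝ)
    (he : s.j = e) : (s.depart e i a).fracDone = s.fracDone := by
  ext e'
  rw [FBTAState.mem_fracDone, FBTAState.mem_fracDone]
  refine and_congr_left fun h => ?_
  have h' : (e' : ℕ) < s.j := h
  have h1 : e' ≠ e := by rintro rfl; omega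
  rw [FBTAState.depart, FracAllocation.holders_set_of_ne _ _ _ h1]

theorem FBTAState.mem_fracDone_takeItem_of_ne {s : FBTAState n m} {e e' : Fin m} (i : Fin n)
    (he : s.j = e) (h : e' ≠ e) : e' ∈ (s.takeItem e i).fracDone ↔ e' ∈ s.fracDone := by
  have h2 : (e' : ℕ) ≠ e := fun hh => h (Fin.ext hh)
  rw [FBTAState.mem_fracDone, FBTAState.mem_fracDone, FBTAState.takeItem,
    FracAllocation.holders_set_of_ne _ _ _ h]
  refine and_congr_right fun _ => ?_
  simp only
  omega

theorem FBTAState.fracDone_takeItem_of_whole {I : GoodsInstance n m} {s : FBTAState n m}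
    (hs : I.Consistent s) {e : Fin m} (i : Fin n) (he : s.j = e) (hz : s.z e = 1) :
    (s.takeItem e i).fracDone = s.fracDone := by
  ext e'
  by_cases h1 : e' = e
  · subst h1
    have h2 : ((s.takeItem e' i).x.holders e').card ≤ 1 := by
      have key : ∀ k, k ∈ (s.takeItem e' i).x.holders e' → k = i := by
        intro k hk
        by_contra hki
        rw [FracAllocation.mem_holders, FBTAState.takeItem_x,
          FracAllocation.set_of_ne_agent _ _ _ hki, hs.x_eq_zero hz] at hk
        exact lt_irrefl _ hk
      exact card_le_one.2 fun k hk l hl => by rw [key k hk, key l hl]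
    rw [FBTAState.mem_fracDone, FBTAState.mem_fracDone]
    omega
  · exact FBTAState.mem_fracDone_takeItem_of_ne i he h1

theorem FBTAState.card_fracDone_takeItem {I : GoodsInstance n m} {s : FBTAState n m}
    (hs : I.Consistent s) {e : Fin m} {i : Fin n} (he : s.j = e) (hi : i ∈ s.active)
    (hz : s.z e < 1) : (s.takeItem e i).fracDone.card = s.fracDone.card + 1 := by
  have hx : ∃ k, 0 < s.x k e := by
    by_contra! hcon
    have := sum_nonpos fun k (_ : k ∈ (univ : Finset (Fin n))) => hcon k
    linarith [hs.sum_add e]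
  obtain ⟨k, hk⟩ := hx
  have hki : k ≠ i := by
    rintro rfl
    rw [hs.active_zero k hi _ he.le] at hk
    exact lt_irrefl _ hk
  have hnot : e ∉ s.fracDone := by
    rw [FBTAState.mem_fracDone]; omega
  rw [← card_insert_of_notMem hnot]
  congr 1
  ext e'
  rw [mem_insert]
  by_cases h1 : e' = e
  · subst h1
    simp only [true_or, iff_true]
    rw [FBTAState.mem_fracDone]
    refine ⟨one_lt_card.2 ⟨k, ?_, i, ?_, hki⟩, by simp only [FBTAState.takeItem]; omega⟩
    · rw [FracAllocation.mem_holders, FBTAState.takeItem_x, FracAllocation.set_of_ne_agent _ _ _ hki]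
      exact hk
    · rw [FracAllocation.mem_holders, FBTAState.takeItem_x, FracAllocation.set_self]
      exact hs.z_pos _ he
  · rw [FBTAState.mem_fracDone_takeItem_of_ne i he h1]
    simp [h1]

/-- The stages of the current item: nobody holds a part of it (`fresh`), one departed agent does
(`shared`), or several do (`crowded`). The potentials `φ` bound the subsidies of the partial
roundings, and unless every departed agent accounts for a fractional item of her own, some agent has
a slack potential. -/
inductive GoodsInstance.Stage (I : GoodsInstance n m) (s : FBTAState n m) (φ : Fin n → ℝ → ℝ) : Prop
  | fresh (hz : ∀ e : Fin m, s.j = e → s.z e = 1)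
      (hc : #s.fracDone ≤ #s.activeᶜ)
      (hslack : #s.fracDone < #s.activeᶜ → ∃ i ∈ s.active, IsSlackPotential (φ i))
      (h : I.HasRoundings s s.j ((#s.activeᶜ : ℕ) / 3 : ℝ) φ)
  | shared (e : Fin m) (ψ : ℝ → ℝ) (he : s.j = e) (hz : s.z e < 1) (hψ : IsPotential ψ)
      (hc : #s.fracDone + 1 ≤ #s.activeᶜ)
      (hslack : #s.fracDone + 1 < #s.activeᶜ →
        (∃ i ∈ s.active, IsSlackPotential (φ i)) ∨ IsSlackPotential ψ)
      (hU : I.HasRoundings s s.j ((#s.activeᶜ : ℕ) / 3 + (ψ 0 + (1 - s.z e) - 1 / 3) : ℝ) φ)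
      (hP : I.HasRoundings s (s.j + 1) ((#s.activeᶜ : ℕ) / 3 + (ψ (s.z e) - 1 / 3) : ℝ) φ)
  | crowded (e : Fin m) (U P : ℝ) (he : s.j = e) (hz : s.z e < 1)
      (hUP : IsCrowdedItem (s.z e) U P)
      (hc : #s.fracDone + 2 ≤ #s.activeᶜ)
      (hU : I.HasRoundings s s.j ((#s.activeᶜ : ℕ) / 3 + U : ℝ) φ)
      (hP : I.HasRoundings s (s.j + 1) ((#s.activeᶜ : ℕ) / 3 + P : ℝ) φ)

/-- The items so far can be rounded with a total subsidy controlled by potentials. -/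
def GoodsInstance.Roundable (I : GoodsInstance n m) (s : FBTAState n m) : Prop :=
  ∃ φ : Fin n → ℝ → ℝ, (∀ i ∈ s.active, IsPotential (φ i)) ∧ I.Stage s φ

theorem GoodsInstance.HasRoundings.min {I : GoodsInstance n m} {s : FBTAState n m} {J : ℕ}
    {p q : ℝ} {φ : Fin n → ℝ → ℝ} (hp : I.HasRoundings s J p φ) (hq : I.HasRoundings s J q φ) :
    I.HasRoundings s J (min p q) φ := by
  rcases min_choice p q with h | h <;> rw [h] <;> assumption

theorem GoodsInstance.HasRoundings.of_le {I : GoodsInstance n m} {s : FBTAState n m} {J : ℕ}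
    {p q : ℝ} {φ : Fin n → ℝ → ℝ} (hp : I.HasRoundings s J p φ) (h : p ≤ q) :
    I.HasRoundings s J q φ :=
  hp.mono fun _ => by linarith

theorem GoodsInstance.Roundable.takeItem {I : GoodsInstance n m} (hI : I.IsIDO)
    {s : FBTAState n m} (hs : I.Consistent s) {e : Fin m} {g : Fin n} (he : s.j = e)
    (hg : g ∈ s.active) (h : I.Roundable s) : I.Roundable (s.takeItem e g) := by
  obtain ⟨φ, hφ, hst⟩ := h
  have hact : (s.takeItem e g).active = s.active := rfl
  have hfresh : ∀ e' : Fin m, (s.takeItem e g).j = e' → (s.takeItem e g).z e' = 1 := by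
    intro e' he'
    simp only [FBTAState.takeItem] at he' ⊢
    have h1 : e' ≠ e := by rintro rfl; omega
    rw [Function.update_of_ne h1]
    exact hs.z_of_gt e' (by omega)
  have hz0 := hs.z_pos e he
  cases hst with
  | fresh hz hc hslack h =>
    have hfd := FBTAState.fracDone_takeItem_of_whole hs g he (hz e he)
    refine ⟨φ, hφ, .fresh hfresh ?_ ?_ ?_⟩
    · rwa [hfd, hact]
    · rwa [hfd, hact]
    · exact h.takeItem_of_whole hs he hg (hz e he)
  | shared e' ψ he' hz hψ hc hslack hU hP =>
    obtain rfl : e' = e := Fin.ext (by omega)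
    have hfd := FBTAState.card_fracDone_takeItem hs he hg hz
    refine ⟨_, ?_, .fresh hfresh ?_ ?_ (GoodsInstance.HasRoundings.takeItem hI hs he hg hU hP)⟩
    · intro i hi
      by_cases hig : i = g
      · subst hig
        rw [Function.update_self]
        exact hψ.combine (hφ i hi) hz0.le hz.le
      · rw [Function.update_of_ne hig]; exact hφ i hi
    · rwa [hfd, hact]
    · rw [hfd, hact]
      intro hlt
      rcases hslack hlt with ⟨i, hi, hi'⟩ | hψ'
      · refine ⟨i, hi, ?_⟩
        by_cases hig : i = g
        · subst hig
          rw [Function.update_self]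
          exact hψ.combine_slack hi' hz0.le hz.le
        · rwa [Function.update_of_ne hig]
      · refine ⟨g, hg, ?_⟩
        rw [Function.update_self]
        exact hψ'.combine (hφ g hg) hz0.le hz.le
  | crowded e' U P he' hz hUP hc hU hP =>
    obtain rfl : e' = e := Fin.ext (by omega)
    have hfd := FBTAState.card_fracDone_takeItem hs he hg hz
    have hsl := hUP.combine (hφ g hg) hz0.le hz.le
    refine ⟨_, ?_, .fresh hfresh ?_ ?_ (GoodsInstance.HasRoundings.takeItem hI hs he hg hU hP)⟩
    · intro i hi
      by_cases hig : i = g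
      · subst hig
        rw [Function.update_self]
        exact hsl.isPotential
      · rw [Function.update_of_ne hig]; exact hφ i hi
    · rw [hfd, hact]; omega
    · exact fun _ => ⟨g, hg, by rwa [Function.update_self]⟩

theorem FBTAState.depart_zero_z (s : FBTAState n m) (e : Fin m) (i : Fin n) :
    (s.depart e i 0).z = s.z := by
  simp [FBTAState.depart]

theorem FBTAState.card_compl_active_depart {s : FBTAState n m} (e : Fin m) {i : Fin n} (a : ℝ)
    (hi : i ∈ s.active) : #(s.depart e i a).activeᶜ = #s.activeᶜ + 1 := by
  simp only [FBTAState.depart]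
  rw [compl_erase, card_insert_of_notMem (by simpa using hi)]

theorem GoodsInstance.HasRoundings.depart_zero {I : GoodsInstance n m} {s : FBTAState n m}
    (hs : I.Consistent s) {e : Fin m} {i g : Fin n} (he : s.j = e) (hi : i ∈ s.active)
    (hg : g ∈ s.active.erase i)
    (hfill : I.fracValue i (s.x i) + 0 * I.v i e = I.share i) {J : ℕ} {B : ℝ}
    {φ : Fin n → ℝ → ℝ} (hφ : IsPotential (φ i)) (h : I.HasRoundings s J B φ) :
    I.HasRoundings (s.depart e i 0) J (B + 1 / 3)
      (Function.update φ g (fun t => φ g t - 1 / 6)) := by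
  refine (h.depart hs he hi le_rfl hfill).mono fun τ => ?_
  have hact : (s.depart e i 0).active = s.active.erase i := rfl
  have hsum := sum_apply_update hg (fun k (f : ℝ → ℝ) => f (τ k)) φ (fun t => φ g t - 1 / 6)
  rw [hact, hsum, ← add_sum_erase _ (fun k => φ k (τ k)) hg]
  linarith [hφ.zero_le]

theorem GoodsInstance.Roundable.depart_zero {I : GoodsInstance n m}
    {s : FBTAState n m} (hs : I.Consistent s) {e : Fin m} {i : Fin n} (he : s.j = e)
    (hi : i ∈ s.active) (hne : (s.active.erase i).Nonempty)
    (hfill : I.fracValue i (s.x i) + 0 * I.v i e = I.share i)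
    (h : I.Roundable s) : I.Roundable (s.depart e i 0) := by
  obtain ⟨φ, hφ, hst⟩ := h
  obtain ⟨g, hg⟩ := hne
  have hgA : g ∈ s.active := mem_of_mem_erase hg
  have hcard := FBTAState.card_compl_active_depart e 0 hi
  have hfd := s.fracDone_depart i 0 he
  have hz' := s.depart_zero_z e i
  have hslack' : ∃ k ∈ (s.depart e i 0).active,
      IsSlackPotential (Function.update φ g (fun t => φ g t - 1 / 6) k) :=
    ⟨g, hg, by rw [Function.update_self]; exact (hφ g hgA).sub_sixth⟩
  have key : ∀ {J : ℕ} {B : ℝ}, I.HasRoundings s J B φ →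
      I.HasRoundings (s.depart e i 0) J (B + 1 / 3) (Function.update φ g (fun t => φ g t - 1 / 6)) := fun h =>
    h.depart_zero hs he hi hg hfill (hφ i hi)
  refine ⟨Function.update φ g (fun t => φ g t - 1 / 6), ?_, ?_⟩
  · intro k hk
    by_cases hkg : k = g
    · subst hkg
      rw [Function.update_self]
      exact (hφ k hgA).sub_sixth.isPotential
    · rw [Function.update_of_ne hkg]; exact hφ k (mem_of_mem_erase hk)
  cases hst with
  | fresh hz hc hslack h =>
    refine .fresh ?_ ?_ (fun _ => hslack') ?_
    · rw [hz']; exact hz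
    · rw [hfd, hcard]; omega
    · exact (key h).of_le (by rw [hcard]; push_cast; linarith)
  | shared e' ψ he' hz hψ hc hslack hU hP =>
    refine .shared e' ψ he' ?_ hψ ?_ (fun _ => Or.inl hslack') ?_ ?_
    · rwa [hz']
    · rw [hfd, hcard]; omega
    · exact (key hU).of_le (by rw [hcard, hz']; push_cast; linarith)
    · exact (key hP).of_le (by rw [hcard, hz']; push_cast; linarith)
  | crowded e' U P he' hz hUP hc hU hP =>
    refine .crowded e' U P he' ?_ ?_ ?_ ?_ ?_
    · rwa [hz']
    · rwa [hz']
    · rw [hfd, hcard]; omega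
    · exact (key hU).of_le (by rw [hcard]; push_cast; linarith)
    · exact (key hP).of_le (by rw [hcard]; push_cast; linarith)

theorem GoodsInstance.Roundable.depart {I : GoodsInstance n m} (hI : I.IsIDO)
    {s : FBTAState n m} (hs : I.Consistent s) {e : Fin m} {i : Fin n} {a : ℝ} (he : s.j = e)
    (hi : i ∈ s.active) (hne : (s.active.erase i).Nonempty) (ha0 : 0 ≤ a) (haz : a < s.z e)
    (hfill : I.fracValue i (s.x i) + a * I.v i e = I.share i)
    (h : I.Roundable s) : I.Roundable (s.depart e i a) := by
  rcases ha0.eq_or_lt with rfl | ha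
  · exact h.depart_zero hs he hi hne hfill
  obtain ⟨φ, hφ, hst⟩ := h
  have hcard := FBTAState.card_compl_active_depart e a hi
  have hfd := s.fracDone_depart i a he
  have hz1 := hs.z_le_one e
  have hz' : (s.depart e i a).z e = s.z e - a := by simp [FBTAState.depart]
  refine ⟨φ, fun k hk => hφ k (mem_of_mem_erase hk), ?_⟩
  cases hst with
  | fresh hz hc hslack h =>
    have hz := hz e he
    refine .shared e (φ i) he (by linarith) (hφ i hi) ?_ ?_ ?_ ?_
    · rw [hfd, hcard]; omega
    · rw [hfd, hcard]
      intro hlt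
      obtain ⟨k, hk, hk'⟩ := hslack (by omega)
      by_cases hki : k = i
      · subst hki; exact Or.inr hk'
      · exact Or.inl ⟨k, mem_erase.2 ⟨hki, hk⟩, hk'⟩
    · exact (h.depart hs he hi ha0 hfill).of_le (by rw [hcard, hz', hz]; push_cast; linarith)
    · refine (h.depart_own hI he hi ha (by linarith) hfill).of_le ?_
      rw [hcard, hz', hz]; push_cast; linarith
  | shared e' ψ he' hz hψ hc hslack hU hP =>
    obtain rfl : e' = e := Fin.ext (by omega)
    refine .crowded e' _ _ he (by linarith)
      (hz' ▸ IsCrowdedItem.of_two hψ (hφ i hi) ha0 haz.le hz1) ?_ ?_ ?_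
    · rw [hfd, hcard]; omega
    · exact (hU.depart hs he hi ha0 hfill).of_le (by rw [hcard]; push_cast; linarith)
    · refine ((hP.depart hs he hi ha0 hfill).min
        (hU.depart_own hI he hi ha (by linarith) hfill)).of_le ?_
      rw [hcard, add_assoc, add_assoc, add_assoc _ _ (φ i (1 - a)), min_add_add_left,
        ← add_assoc _ (φ i 0)]
      push_cast; linarith
  | crowded e' U P he' hz hUP hc hU hP =>
    obtain rfl : e' = e := Fin.ext (by omega)
    refine .crowded e' _ _ he (by linarith)
      (hz' ▸ hUP.depart (hφ i hi) ha0 haz.le hz1) ?_ ?_ ?_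
    · rw [hfd, hcard]; omega
    · exact (hU.depart hs he hi ha0 hfill).of_le (by rw [hcard]; push_cast; linarith)
    · refine ((hP.depart hs he hi ha0 hfill).min
        (hU.depart_own hI he hi ha (by linarith) hfill)).of_le ?_
      rw [hcard, add_assoc, add_assoc, add_assoc _ _ (φ i (1 - a)), min_add_add_left,
        ← add_assoc _ (φ i 0)]
      push_cast; linarith

theorem FBTAState.finish_takeItem (s : FBTAState n m) {e : Fin m} {k : Fin n} (hx : s.x k e = 0) :
    (s.takeItem e k).finish k = s.finish k := by
  simp only [FBTAState.finish, FBTAState.takeItem, FBTAState.mk.injEq, and_true]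
  ext i e'
  by_cases hi : i = k
  · subst hi
    simp only [Function.update_self]
    by_cases he : e' = e
    · subst he; simp [FracAllocation.set_self, hx]
    · simp [FracAllocation.set_of_ne_item _ _ _ _ he, he]
  · simp [hi, FracAllocation.set_of_ne_agent _ _ _ hi]

theorem GoodsInstance.finish_spec {I : GoodsInstance n m} (hI : I.IsIDO) {k : Fin n} (d : ℕ) :
    ∀ {s : FBTAState n m}, m - s.j = d → s.active = {k} → I.Consistent s → I.Roundable s →
      I.Consistent (s.finish k) ∧ I.Roundable (s.finish k) := by
  induction d with
  | zero =>
    intro s hd hA hs hr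
    have hj : s.j = m := by have := hs.j_le; omega
    have hz : s.z = fun _ => 0 := funext fun e => hs.z_of_lt e (by omega)
    have : s.finish k = s := by
      obtain ⟨x, A, z, j⟩ := s
      simp only at hA hj hz
      subst hA hj hz
      simp [FBTAState.finish]
    rw [this]
    exact ⟨hs, hr⟩
  | succ d ih =>
    intro s hd hA hs hr
    have hlt : s.j < m := by omega
    have hk : k ∈ s.active := by simp [hA]
    have he : s.j = ((⟨s.j, hlt⟩ : Fin m) : ℕ) := rfl
    rw [← s.finish_takeItem (hs.active_zero k hk ⟨s.j, hlt⟩ he.le)]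
    exact ih (by simp only [FBTAState.takeItem]; omega) hA (hs.takeItem he hk)
      (hr.takeItem hI hs he hk)

theorem GoodsInstance.fracValue_nonneg (I : GoodsInstance n m) (i : Fin n) {y : Fin m → ℝ}
    (hy : ∀ e, 0 ≤ y e) : 0 ≤ I.fracValue i y :=
  sum_nonneg fun e _ => mul_nonneg (hy e) (I.v_nonneg i e)

theorem GoodsInstance.total_nonneg (I : GoodsInstance n m) (i : Fin n) : 0 ≤ I.total i := by
  rw [GoodsInstance.total, GoodsInstance.value]
  exact sum_nonneg fun e _ => I.v_nonneg i e

/-- An agent receives her share if the items are completely allocated, the other agents do not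
exceed their shares, and all holders of an item have at least her normalized value for it. -/
theorem GoodsInstance.share_le_fracValue (I : GoodsInstance n m) {x : FracAllocation n m}
    (hx : ∀ i e, 0 ≤ x i e) (hsum : ∀ e, ∑ i, x i e = 1) (k : Fin n)
    (hle : ∀ i, i ≠ k → I.fracValue i (x i) ≤ I.share i)
    (htop : ∀ i e, 0 < x i e → I.v k e / I.total k ≤ I.v i e / I.total i) :
    I.share k ≤ I.fracValue k (x k) := by
  rcases (I.total_nonneg k).eq_or_lt with h0 | h0
  · rw [GoodsInstance.share, ← h0, mul_zero]
    exact I.fracValue_nonneg k (hx k)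
  have h1 : (1 : ℝ) = ∑ i, ∑ e, x i e * (I.v k e / I.total k) := by
    rw [sum_comm]
    simp only [← sum_mul, hsum, one_mul, ← sum_div]
    exact (div_self h0.ne').symm
  have h2 : ∀ i, ∑ e, x i e * (I.v k e / I.total k) ≤ I.fracValue i (x i) / I.total i := by
    intro i
    rw [GoodsInstance.fracValue, sum_div]
    refine sum_le_sum fun e _ => ?_
    rw [mul_div_assoc]
    rcases (hx i e).eq_or_lt with h | h
    · simp [← h]
    · exact mul_le_mul_of_nonneg_left (htop i e h) h.le
  have h3 : ∀ i, i ≠ k → I.fracValue i (x i) / I.total i ≤ I.w i := by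
    intro i hi
    rcases (I.total_nonneg i).eq_or_lt with h | h
    · rw [← h, div_zero]; exact (I.w_pos i).le
    · rw [div_le_iff₀ h]; exact hle i hi
  have h4 : (1 : ℝ) ≤ I.fracValue k (x k) / I.total k + ∑ i ∈ univ.erase k, I.w i := by
    calc (1 : ℝ) ≤ ∑ i, I.fracValue i (x i) / I.total i := h1.trans_le (sum_le_sum fun i _ => h2 i)
      _ ≤ _ := by
        rw [← add_sum_erase _ _ (mem_univ k)]
        gcongr with i hi
        exact h3 i (ne_of_mem_erase hi)
  have h5 := add_sum_erase univ I.w (mem_univ k)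
  rw [I.w_sum] at h5
  have h6 : I.w k ≤ I.fracValue k (x k) / I.total k := by linarith
  rwa [le_div_iff₀ h0] at h6

/-- The invariant of the main loop: active agents do not exceed their shares, all holders of an item
have the largest normalized value for it among the active agents, and at least two agents are
active. -/
structure GoodsInstance.LoopInvariant (I : GoodsInstance n m) (s : FBTAState n m) : Prop where
  le_share : ∀ i ∈ s.active, I.fracValue i (s.x i) ≤ I.share i
  top : ∀ k ∈ s.active, ∀ i e, 0 < s.x i e → I.v k e / I.total k ≤ I.v i e / I.total i
  active_card : 2 ≤ #s.active ∨ n = 1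

/-- The invariant of all states that the algorithm reaches. -/
structure GoodsInstance.Invariant (I : GoodsInstance n m) (s : FBTAState n m) : Prop where
  consistent : I.Consistent s
  roundable : I.Roundable s
  active_nonempty : s.active.Nonempty
  loop_or_done : I.LoopInvariant s ∨
    s.j = m ∧ ∀ k ∈ s.active, I.share k ≤ I.fracValue k (s.x k)

theorem GoodsInstance.n_pos (I : GoodsInstance n m) : 0 < n := by
  rcases Nat.eq_zero_or_pos n with rfl | h
  · have := I.w_sum
    simp at this
  · exact h

theorem GoodsInstance.invariant_init (I : GoodsInstance n m) :
    I.Invariant (FBTAState.init n m) where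
  consistent :=
    { j_le := Nat.zero_le m
      x_nonneg := fun _ _ => le_rfl
      sum_add := fun _ => by simp [FBTAState.init]
      z_of_lt := fun _ h => absurd h (Nat.not_lt_zero _)
      z_of_gt := fun _ _ => rfl
      z_pos := fun _ _ => one_pos
      active_zero := fun _ _ _ _ => rfl
      departed := fun i hi => absurd (mem_univ i) hi }
  roundable := by
    refine ⟨fun _ _ => 0, fun _ _ => isPotential_zero, .fresh (fun _ _ => rfl) ?_ ?_ ?_⟩
    · have : (FBTAState.init n m).fracDone = ∅ := by
        ext e; simp [FBTAState.mem_fracDone, FBTAState.init]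
      simp [this]
    · simp [FBTAState.init]
    · intro τ hτ
      refine ⟨fun _ => ⟨0, I.n_pos⟩, fun _ => 0, ⟨fun e he => absurd he (Nat.not_lt_zero _),
        fun _ => le_rfl, fun i hi => absurd (mem_univ i) hi, fun i _ c hc _ => ?_⟩, ?_⟩
      · simp only [FBTAState.init, GoodsInstance.fracValue, GoodsInstance.ownValue, zero_mul,
          sum_const_zero, Nat.not_lt_zero, false_and, if_false, zero_add]
        exact mul_nonneg (hτ i) hc
      · simp [FBTAState.init]
  active_nonempty := ⟨⟨0, I.n_pos⟩, mem_univ _⟩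
  loop_or_done := by
    refine Or.inl ⟨fun i _ => ?_, fun _ _ _ _ h => absurd h (lt_irrefl _), ?_⟩
    · simp only [FBTAState.init, GoodsInstance.fracValue, zero_mul, sum_const_zero]
      exact mul_nonneg (I.w_pos i).le (I.total_nonneg i)
    · have := I.n_pos
      simp only [FBTAState.init, card_univ, Fintype.card_fin]
      omega

theorem GoodsInstance.Consistent.le_share_of_subsingleton {I : GoodsInstance n m}
    {s : FBTAState n m} (hs : I.Consistent s) (hn : n = 1) (i : Fin n) (e : Fin m) :
    I.fracValue i (s.x i) + s.z e * I.v i e ≤ I.share i := by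
  subst hn
  have hw : I.w i = 1 := by rw [← I.w_sum, Fintype.sum_subsingleton _ i]
  rw [GoodsInstance.share, hw, one_mul, GoodsInstance.total, GoodsInstance.value,
    GoodsInstance.fracValue]
  have h1 : ∀ e', I.v i e' = s.x i e' * I.v i e' + s.z e' * I.v i e' := by
    intro e'
    have := hs.sum_add e'
    rw [Fintype.sum_subsingleton _ i] at this
    rw [← add_mul, this, one_mul]
  rw [sum_congr rfl fun e' _ => h1 e', sum_add_distrib]
  gcongr
  refine single_le_sum (f := fun e' => s.z e' * I.v i e') (fun e' _ => ?_) (mem_univ e)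
  refine mul_nonneg ?_ (I.v_nonneg i e')
  rcases lt_trichotomy (e' : ℕ) s.j with h | h | h
  · rw [hs.z_of_lt e' h]
  · exact (hs.z_pos e' h.symm).le
  · rw [hs.z_of_gt e' h]; exact zero_le_one

/-- An agent who cannot take all that remains of an item departs with a proper part of it. -/
theorem GoodsInstance.depart_amount {I : GoodsInstance n m} {s : FBTAState n m} {e : Fin m}
    {i : Fin n} {a : ℝ} (hle : I.fracValue i (s.x i) ≤ I.share i)
    (hgt : I.share i < I.fracValue i (s.x i) + s.z e * I.v i e)
    (ha : a = (I.share i - I.fracValue i (s.x i)) / I.v i e) :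
    0 ≤ a ∧ a < s.z e ∧ I.fracValue i (s.x i) + a * I.v i e = I.share i := by
  have hv : 0 < I.v i e := by
    rcases (I.v_nonneg i e).eq_or_lt with h | h
    · rw [← h, mul_zero] at hgt; linarith
    · exact h
  subst ha
  refine ⟨div_nonneg (by linarith) hv.le, ?_, ?_⟩
  · rw [div_lt_iff₀ hv]; linarith
  · rw [div_mul_cancel₀ _ hv.ne']; ring

theorem GoodsInstance.LoopInvariant.depart {I : GoodsInstance n m} {s : FBTAState n m}
    (h : I.LoopInvariant s) {e : Fin m} {i : Fin n} (a : ℝ) (hi : I.IsTopBidder s.active e i)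
    (k : Fin n) (hk : k ∈ s.active.erase i) :
    I.fracValue k ((s.depart e i a).x k) ≤ I.share k ∧
    ∀ l e', 0 < (s.depart e i a).x l e' → I.v k e' / I.total k ≤ I.v l e' / I.total l := by
  simp only [FBTAState.depart]
  refine ⟨?_, fun l e' hl => ?_⟩
  · rw [FracAllocation.set_of_ne_agent _ _ _ (ne_of_mem_erase hk)]
    exact h.le_share k (mem_of_mem_erase hk)
  · by_cases h1 : e' = e
    · subst h1
      by_cases h2 : l = i
      · subst h2; exact hi.2 k (mem_of_mem_erase hk)
      · rw [FracAllocation.set_of_ne_agent _ _ _ h2] at hl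
        exact h.top k (mem_of_mem_erase hk) l e' hl
    · rw [FracAllocation.set_of_ne_item _ _ _ _ h1] at hl
      exact h.top k (mem_of_mem_erase hk) l e' hl

theorem GoodsInstance.Invariant.step {I : GoodsInstance n m} (hI : I.IsIDO) {s s' : FBTAState n m}
    (hs : I.Invariant s) (h : I.FBTAStep s s') : I.Invariant s' := by
  obtain ⟨hc, hr, hne, hloop⟩ := hs
  have hlt : s.j < m := by
    cases h with
    | take e i he => have := e.2; omega
    | leave e i a he => have := e.2; omega
    | last e i k a z' he => have := e.2; omega
  have hl : I.LoopInvariant s := hloop.resolve_right fun h => by omega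
  have herase : ∀ (e : Fin m) (i : Fin n),
      I.share i < I.fracValue i (s.x i) + s.z e * I.v i e → i ∈ s.active →
      (s.active.erase i).Nonempty := by
    intro e i hgt hi
    rcases hl.active_card with h2 | h2
    · rw [← card_pos, card_erase_of_mem hi]; omega
    · exact absurd (hc.le_share_of_subsingleton h2 i e) hgt.not_ge
  cases h with
  | take e i he hi hle =>
    refine ⟨hc.takeItem he hi.1, hr.takeItem hI hc he hi.1, hne, Or.inl ⟨?_, ?_, hl.active_card⟩⟩
    · intro k hk
      by_cases hki : k = i
      · subst hki
        simp only
        rw [I.fracValue_set _ _ (hc.active_zero k hk _ he.le)]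
        exact hle
      · simp only
        rw [FracAllocation.set_of_ne_agent _ _ _ hki]
        exact hl.le_share k hk
    · intro k hk l e' hpos
      simp only at hpos hk
      by_cases h1 : e' = e
      · subst h1
        by_cases h2 : l = i
        · subst h2; exact hi.2 k hk
        · rw [FracAllocation.set_of_ne_agent _ _ _ h2] at hpos
          exact hl.top k hk l e' hpos
      · rw [FracAllocation.set_of_ne_item _ _ _ _ h1] at hpos
        exact hl.top k hk l e' hpos
  | leave e i a he hi hgt ha hcard =>
    obtain ⟨ha0, haz, hfill⟩ := GoodsInstance.depart_amount (hl.le_share i hi.1) hgt ha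
    have hne' := herase e i hgt hi.1
    refine ⟨hc.depart he hi.1 ha0 haz hfill, hr.depart hI hc he hi.1 hne' ha0 haz hfill, hne',
      Or.inl ⟨fun k hk => (hl.depart a hi k hk).1, fun k hk => (hl.depart a hi k hk).2, Or.inl ?_⟩⟩
    have := card_pos.2 hne'
    change 2 ≤ #(s.active.erase i)
    omega
  | last e i k a z' he hi hgt ha hk hz =>
    obtain ⟨ha0, haz, hfill⟩ := GoodsInstance.depart_amount (hl.le_share i hi.1) hgt ha
    have hne' := herase e i hgt hi.1
    have hki : k ≠ i := ne_of_mem_erase (by rw [hk]; exact mem_singleton_self k)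
    have hkA : k ∈ s.active.erase i := by rw [hk]; exact mem_singleton_self k
    have hc1 := hc.depart he hi.1 ha0 haz hfill
    obtain ⟨hc2, hr2⟩ := GoodsInstance.finish_spec hI _ rfl hk hc1
      (hr.depart hI hc he hi.1 hne' ha0 haz hfill)
    have heq : (s.depart e i a).finish k =
        { x := Function.update (s.x.set i e a) k (fun e' => s.x k e' + z' e')
          active := {k}
          z := fun _ => 0
          j := m } := by
      subst hz
      simp only [FBTAState.finish, FBTAState.depart, FracAllocation.set_of_ne_agent _ _ _ hki]
    rw [← heq]
    refine ⟨hc2, hr2, singleton_nonempty k, Or.inr ⟨rfl, fun k' hk' => ?_⟩⟩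
    obtain rfl : k' = k := mem_singleton.1 hk'
    have hx : ∀ l, l ≠ k' → ((s.depart e i a).finish k').x l = (s.depart e i a).x l := fun l hl =>
      Function.update_of_ne hl _ _
    refine I.share_le_fracValue hc2.x_nonneg (fun e' => ?_) k' (fun l hlk => ?_) fun l e' hpos => ?_
    · have := hc2.sum_add e'
      simpa [FBTAState.finish] using this
    · refine (hc2.departed l ?_).le
      simpa [FBTAState.finish] using hlk
    · by_cases hlk : l = k'
      · rw [hlk]
      · rw [hx l hlk] at hpos
        exact (hl.depart a hi k' hkA).2 l e' hpos

theorem GoodsInstance.Invariant.share_le {I : GoodsInstance n m} {s : FBTAState n m}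
    (h : I.Invariant s) (hj : s.j = m) {k : Fin n} (hk : k ∈ s.active) :
    I.share k ≤ I.fracValue k (s.x k) := by
  rcases h.loop_or_done with hl | hd
  · refine I.share_le_fracValue h.consistent.x_nonneg (fun e => ?_) k (fun i _ => ?_) (hl.top k hk)
    · have := h.consistent.sum_add e
      rwa [h.consistent.z_of_lt e (by omega), add_zero] at this
    · by_cases hi : i ∈ s.active
      · exact hl.le_share i hi
      · exact (h.consistent.departed i hi).le
  · exact hd.2 k hk

/-- At the end of the algorithm, a partial rounding is a weighted proportional rounding. -/
theorem GoodsInstance.Invariant.hasRoundingWithSubsidy {I : GoodsInstance n m} {s : FBTAState n m}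
    (h : I.Invariant s) (hj : s.j = m) {B : ℝ} {φ : Fin n → ℝ → ℝ} (hr : I.HasRoundings s s.j B φ) :
    I.HasRoundingWithSubsidy s.x (B + ∑ i ∈ s.active, φ i 0) := by
  obtain ⟨o, σ, h1, h2⟩ := hr (fun _ => 0) fun _ => le_rfl
  have hval : ∀ i, I.ownValue o s.j i = I.value i {e | o e = i} := by
    intro i
    rw [GoodsInstance.ownValue, GoodsInstance.value, sum_filter]
    refine sum_congr rfl fun e _ => ?_
    have : (e : ℕ) < s.j := by omega
    simp [this]
  refine ⟨fun i => {e | o e = i}, σ, ⟨⟨fun i k hik => ?_, fun e => ⟨o e, by simp⟩⟩, fun i e he => ?_⟩,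
    ⟨h1.nonneg, fun i => ?_⟩, h2⟩
  · rw [disjoint_left]
    intro e he hk
    simp only [mem_filter, mem_univ, true_and] at he hk
    exact hik (he.symm.trans hk)
  · simp only [mem_filter, mem_univ, true_and] at he
    have := h1.pos e (by omega)
    rwa [he] at this
  · rw [← hval]
    by_cases hi : i ∈ s.active
    · have h3 := h1.active i hi 1 zero_le_one fun e _ => I.v_le_one i e
      have h4 := h.share_le hj hi
      linarith
    · exact h1.departed i hi

theorem GoodsInstance.HasRoundingWithSubsidy.of_le {I : GoodsInstance n m} {x : FracAllocation n m}
    {B B' : ℝ} (h : I.HasRoundingWithSubsidy x B) (hB : B ≤ B') : I.HasRoundingWithSubsidy x B' :=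
  let ⟨X, s, h1, h2, h3⟩ := h
  ⟨X, s, h1, h2, h3.trans hB⟩

end

theorem mainTheorem7 {n m : ℕ} (I : GoodsInstance n m) (hI : I.IsIDO)
    (x : FracAllocation n m) (hx : I.IsFBTAOutput x) :
    x.fractionalItems.card + 1 ≤ n ∧
    (x.fractionalItems.card + 1 = n → I.HasRoundingWithSubsidy x ((n : ℝ) / 3)) ∧
    (x.fractionalItems.card + 1 < n → I.HasRoundingWithSubsidy x (((n : ℝ) - 1) / 3)) := by
  obtain ⟨s, hreach, hj, rfl⟩ := hx
  have hinv : I.Invariant s := by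
    clear hj
    induction hreach with
    | refl => exact I.invariant_init
    | tail _ hstep ih => exact ih.step hI hstep
  obtain ⟨φ, hφ, hst⟩ := hinv.roundable
  have hfd : s.fracDone = s.x.fractionalItems := by
    ext e
    have : (e : ℕ) < s.j := by omega
    simp [FBTAState.fracDone, this]
  have hA := card_pos.2 hinv.active_nonempty
  have hcompl : #s.activeᶜ + #s.active = n := by
    rw [add_comm, card_add_card_compl, Fintype.card_fin]
  have hcompl' : (#s.activeᶜ : ℝ) + #s.active = n := by exact_mod_cast hcompl
  cases hst with
  | shared e => have := e.2; omega
  | crowded e => have := e.2; omega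
  | fresh hz hc hslack h =>
    rw [hfd] at hc hslack
    have hmain := hinv.hasRoundingWithSubsidy hj h
    have hsum : ∑ i ∈ s.active, φ i 0 ≤ #s.active * (1 / 6 : ℝ) := by
      rw [← nsmul_eq_mul]
      exact sum_le_card_nsmul _ _ _ fun i hi => (hφ i hi).zero_le
    refine ⟨by omega, fun _ => hmain.of_le ?_, fun hlt => hmain.of_le ?_⟩
    · have : (0 : ℝ) ≤ #s.active := Nat.cast_nonneg _
      linarith
    · rcases Nat.lt_or_ge 1 #s.active with h2 | h2
      · have : (2 : ℝ) ≤ #s.active := by exact_mod_cast h2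
        linarith
      · have h3 : #s.active = 1 := by omega
        obtain ⟨i, hi, hi'⟩ := hslack (by omega)
        obtain ⟨k, hk⟩ := card_eq_one.1 h3
        have hik : i = k := by rw [hk] at hi; exact mem_singleton.1 hi
        have h4 : ∑ i ∈ s.active, φ i 0 = φ i 0 := by rw [hk, sum_singleton, hik]
        rw [h3, Nat.cast_one] at hcompl'
        linarith [hi'.zero_le]
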